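/- Let $X$ be a paracompact (Hausdorff) complex manifold, $\mathcal O_X$ its sheaf of holomorphic functions, $\mathcal O_X^*$ the sheaf of nowhere vanishing holomorphic functions and $\Omega^1_X$ the sheaf of holomorphic $1$-forms. A holomorphic connection on a holomorphic line bundle $L$ (identified with its sheaf of holomorphic sections) is a $\mathbb C$-linear morphism of sheaves $\nabla: L\to\Omega^1_X\otimes_{\mathcal O_X} L$ with $\nabla(fs)=f\nabla(s)+df\otimes s$. Let $\mathrm{Pic}^{an}(X)$ be the set of isomorphism classes of holomorphic line bundles on $X$, and $\mathrm{Pic}^{an}_c(X)$ the set of isomorphism classes of pairs $(L,\nabla)$ of a holomorphic line bundle with a holomorphic connection; both are abelian groups under the tensor product, where $L\otimes L'$ carries the connection $s\otimes t\mapsto\nabla s\otimes t+s\otimes\nabla' t$. Let $H^1(X,\Omega^1_X)$ be the first cohomology group, computed as the direct limit of the \v{C}ech groups $H^1(\mathcal U,\Omega^1_X)$ over all open coverings $\mathcal U$ of $X$. Then there is an exact sequence of abelian groups $$H^0(X,\mathcal O_X^*)\to H^0(X,\Omega^1_X)\to \mathrm{Pic}^{an}_c(X)\to \mathrm{Pic}^{an}(X)\to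 H^1(X,\Omega^1_X),$$ whose maps are $g\mapsto dg/g$; $\omega\mapsto$ the class of $(\mathcal O_X,\ f\mapsto df+f\omega)$; the class of $(L,\nabla)\mapsto$ the class of $L$; and the class of $L\mapsto$ the class of the \v{C}ech cocycle $(dg_{ij}/g_{ij})$, where $(s_i)$ are nowhere vanishing holomorphic sections of $L$ over the members of an open covering $(U_i)$ and $s_j=g_{ij}s_i$ on $U_i\cap U_j$. In particular, $L$ admits a holomorphic connection if and only if its image in $H^1(X,\Omega^1_X)$ vanishes. -/

import Mathlib

open scoped Manifold ContDiff Topology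
open Bundle TopologicalSpace

noncomputable section

namespace HolLine

section Sections

variable {E : Type*} [NormedAddCommGroup E] [NormedSpace ℂ E]
  {X : Type*} [TopologicalSpace X] [ChartedSpace E X]

/-- The ring `𝒪(U)` of holomorphic functions on an open subset `U` of the complex manifold `X`.
The extension `t` is an arbitrary function; it is only required to be holomorphic on `U`. -/
def holFun (E : Type*) [NormedAddCommGroup E] [NormedSpace ℂ E]
    {X : Type*} [TopologicalSpace X] [ChartedSpace E X] (U : Opens X) :
    Subalgebra ℂ (U → ℂ) where
  carrier := {f | ∃ t : X → ℂ, ContMDiffOn 𝓘(ℂ, E) 𝓘(ℂ, ℂ) ω t U ∧ ∀ x : U, t x = f x}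
  mul_mem' := by
    rintro f g ⟨t, ht, htf⟩ ⟨u, hu, hug⟩
    exact ⟨fun x => t x * u x, ht.mul hu, fun x => by simp [htf, hug]⟩
  add_mem' := by
    rintro f g ⟨t, ht, htf⟩ ⟨u, hu, hug⟩
    exact ⟨fun x => t x + u x, ht.add hu, fun x => by simp [htf, hug]⟩
  algebraMap_mem' c := ⟨fun _ => c, contMDiffOn_const, fun _ => rfl⟩

/-- The `𝒪(U)`-module of holomorphic sections over `U` of a vector bundle `V` on `X`
with model fibre `F`. Again the extension `t` is arbitrary outside `U`. -/
def holSec (E : Type*) [NormedAddCommGroup E] [NormedSpace ℂ E]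
    {X : Type*} [TopologicalSpace X] [ChartedSpace E X]
    (F : Type*) [NormedAddCommGroup F] [NormedSpace ℂ F]
    (V : X → Type*) [TopologicalSpace (TotalSpace F V)] [∀ x, AddCommGroup (V x)]
    [∀ x, Module ℂ (V x)] [∀ x, TopologicalSpace (V x)] [FiberBundle F V] [VectorBundle ℂ F V]
    (U : Opens X) : Submodule (holFun E U) (∀ x : U, V x) where
  carrier := {s | ∃ t : ∀ x, V x,
    ContMDiffOn 𝓘(ℂ, E) (𝓘(ℂ, E).prod 𝓘(ℂ, F)) ω (fun x => TotalSpace.mk' F x (t x)) U ∧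
      ∀ x : U, t x = s x}
  add_mem' := by
    rintro f g ⟨t, ht, htf⟩ ⟨u, hu, hug⟩
    exact ⟨t + u, ht.add_section hu, fun x => by simp [htf, hug]⟩
  zero_mem' := ⟨0, contMDiffOn_zeroSection ℂ V, fun _ => rfl⟩
  smul_mem' := by
    rintro ⟨c, t, ht, htc⟩ s ⟨u, hu, hus⟩
    refine ⟨t • u, ht.smul_section hu, fun x => ?_⟩
    change t x • u x = c x • s x
    rw [htc, hus]

/-- The type of holomorphic sections of `V` over `U`. -/
def HolSec (E : Type*) [NormedAddCommGroup E] [NormedSpace ℂ E]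
    {X : Type*} [TopologicalSpace X] [ChartedSpace E X]
    (F : Type*) [NormedAddCommGroup F] [NormedSpace ℂ F]
    (V : X → Type*) [TopologicalSpace (TotalSpace F V)] [∀ x, AddCommGroup (V x)]
    [∀ x, Module ℂ (V x)] [∀ x, TopologicalSpace (V x)] [FiberBundle F V] [VectorBundle ℂ F V]
    (U : Opens X) : Type _ := ↥(holSec E F V U)

/-- Restriction of holomorphic functions. -/
def holFun.res {U W : Opens X} (h : W ≤ U) (f : holFun E U) : holFun E W :=
  ⟨fun x => f.1 ⟨x, h x.2⟩, by
    obtain ⟨t, ht, e⟩ := f.2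
    exact ⟨t, ht.mono h, fun x => e ⟨x, h x.2⟩⟩⟩

namespace HolSec

variable {F : Type*} [NormedAddCommGroup F] [NormedSpace ℂ F]
    {V : X → Type*} [TopologicalSpace (TotalSpace F V)] [∀ x, AddCommGroup (V x)]
    [∀ x, Module ℂ (V x)] [∀ x, TopologicalSpace (V x)] [FiberBundle F V] [VectorBundle ℂ F V] {U W : Opens X}

instance : AddCommGroup (HolSec E F V U) := inferInstanceAs (AddCommGroup (holSec E F V U))

instance : Module (holFun E U) (HolSec E F V U) :=
  inferInstanceAs (Module (holFun E U) (holSec E F V U))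

/-- Complex scalars act on sections as constant functions. -/
instance : Module ℂ (HolSec E F V U) := Module.compHom _ (algebraMap ℂ (holFun E U))

@[ext]
theorem ext {s t : HolSec E F V U} (h : ∀ x, s.1 x = t.1 x) : s = t := Subtype.ext (funext h)

theorem add_apply (s t : HolSec E F V U) (x : U) : (s + t).1 x = s.1 x + t.1 x := rfl

theorem smul_apply (f : holFun E U) (s : HolSec E F V U) (x : U) :
    (f • s).1 x = f.1 x • s.1 x := rfl

/-- Restriction of holomorphic sections. -/
def res (h : W ≤ U) : HolSec E F V U →+ HolSec E F V W where
  toFun s := ⟨fun x => s.1 ⟨x, h x.2⟩, by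
    obtain ⟨t, ht, e⟩ := s.2
    exact ⟨t, ht.mono h, fun x => e ⟨x, h x.2⟩⟩⟩
  map_zero' := rfl
  map_add' _ _ := rfl

end HolSec

end Sections

section Forms

variable (E : Type*) [NormedAddCommGroup E] [NormedSpace ℂ E]
  {X : Type*} [TopologicalSpace X] [ChartedSpace E X] [IsManifold 𝓘(ℂ, E) ω X]

/-- The space `Ω¹(U)` of holomorphic `1`-forms on `U`: holomorphic sections of the cotangent
bundle `Hom(TX, ℂ)`. -/
abbrev holForm (U : Opens X) : Type _ :=
  HolSec E (E →L[ℂ] ℂ) (fun x : X => TangentSpace 𝓘(ℂ, E) x →L[ℂ] Bundle.Trivial X ℂ x) U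

variable {E}

open Classical in
/-- Extension by zero of a function on an open subset. -/
def extendZero {U : Opens X} (f : U → ℂ) (x : X) : ℂ := if h : x ∈ U then f ⟨x, h⟩ else 0

theorem extendZero_apply {U : Opens X} (f : U → ℂ) (x : U) : extendZero f x = f x := by
  simp [extendZero]

theorem contMDiffOn_extendZero {U : Opens X} (f : holFun E U) :
    ContMDiffOn 𝓘(ℂ, E) 𝓘(ℂ, ℂ) ω (extendZero f.1) U := by
  obtain ⟨t, ht, e⟩ := f.2
  refine ht.congr fun x hx => ?_
  rw [e ⟨x, hx⟩]
  exact extendZero_apply f.1 ⟨x, hx⟩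

theorem mdifferentiableAt_extendZero {U : Opens X} (f : holFun E U) (x : U) :
    MDifferentiableAt 𝓘(ℂ, E) 𝓘(ℂ, ℂ) (extendZero f.1) x :=
  ((contMDiffOn_extendZero f).contMDiffAt (U.2.mem_nhds x.2)).mdifferentiableAt (by simp)

/-- The exterior derivative `d : 𝒪(U) → Ω¹(U)`. -/
def dForm {U : Opens X} (f : holFun E U) : holForm E U :=
  ⟨fun x => (mfderiv 𝓘(ℂ, E) 𝓘(ℂ, ℂ) (extendZero f.1) x : E →L[ℂ] ℂ), by
    refine ⟨fun x => (mfderiv 𝓘(ℂ, E) 𝓘(ℂ, ℂ) (extendZero f.1) x : E →L[ℂ] ℂ), ?_, fun _ => rfl⟩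
    intro x hx
    refine ContMDiffAt.contMDiffWithinAt ?_
    rw [contMDiffAt_hom_bundle]
    refine ⟨contMDiffAt_id, ?_⟩
    have h := ((contMDiffOn_extendZero f).contMDiffAt (U.2.mem_nhds hx)).mfderiv_const
      (m := ω) (by simp)
    refine h.congr_of_eventuallyEq ?_
    refine Filter.Eventually.of_forall fun y => ?_
    ext v
    simp [inTangentCoordinates, ContinuousLinearMap.inCoordinates]
    rfl⟩

theorem dForm_add {U : Opens X} (f g : holFun E U) : dForm (f + g) = dForm f + dForm g := by
  have h : extendZero (f + g).1 = extendZero f.1 + extendZero g.1 := by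
    funext x
    by_cases hx : x ∈ U <;> simp [extendZero, hx]
  ext x v
  change mfderiv 𝓘(ℂ, E) 𝓘(ℂ, ℂ) (extendZero (f + g).1) x.1 v = _
  rw [h, mfderiv_add (mdifferentiableAt_extendZero f x) (mdifferentiableAt_extendZero g x)]
  rfl

theorem dForm_mul {U : Opens X} (f g : holFun E U) :
    dForm (f * g) = f • dForm g + g • dForm f := by
  have h : extendZero (f * g).1 = extendZero f.1 * extendZero g.1 := by
    funext x
    by_cases hx : x ∈ U <;> simp [extendZero, hx]
  ext x v
  change mfderiv 𝓘(ℂ, E) 𝓘(ℂ, ℂ) (extendZero (f * g).1) x.1 v = _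
  rw [h, ((mdifferentiableAt_extendZero f x).hasMFDerivAt.mul
    (mdifferentiableAt_extendZero g x).hasMFDerivAt).mfderiv, extendZero_apply, extendZero_apply]
  rfl

theorem dForm_algebraMap {U : Opens X} (c : ℂ) : dForm (algebraMap ℂ (holFun E U) c) = 0 := by
  ext x v
  change mfderiv 𝓘(ℂ, E) 𝓘(ℂ, ℂ) (extendZero fun _ => c) x.1 v = _
  have h : (extendZero fun _ : U => c) =ᶠ[𝓝 x.1] fun _ => c := by
    filter_upwards [U.2.mem_nhds x.2] with y hy
    exact extendZero_apply _ ⟨y, hy⟩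
  rw [h.mfderiv_eq, mfderiv_const]
  rfl

theorem dForm_res {U W : Opens X} (h : W ≤ U) (f : holFun E U) :
    dForm (holFun.res h f) = HolSec.res h (dForm f) := by
  have e (x : W) : extendZero (holFun.res h f).1 =ᶠ[𝓝 x.1] extendZero f.1 := by
    filter_upwards [W.2.mem_nhds x.2] with y hy
    rw [extendZero_apply (holFun.res h f).1 ⟨y, hy⟩]
    exact (extendZero_apply f.1 ⟨y, h hy⟩).symm
  ext x v
  change mfderiv 𝓘(ℂ, E) 𝓘(ℂ, ℂ) (extendZero (holFun.res h f).1) x.1 v =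
    mfderiv 𝓘(ℂ, E) 𝓘(ℂ, ℂ) (extendZero f.1) x.1 v
  rw [(e x).mfderiv_eq]
  rfl

/-- The logarithmic derivative `g ↦ dg / g` from `𝒪^*(U)` (written additively) to `Ω¹(U)`. -/
def dlog (U : Opens X) : Additive (holFun E U)ˣ →+ holForm E U where
  toFun g := (↑(Additive.toMul g)⁻¹ : holFun E U) • dForm (↑(Additive.toMul g) : holFun E U)
  map_zero' := by
    have h : dForm (1 : holFun E U) = 0 := by
      simpa using dForm_algebraMap (E := E) (U := U) 1
    simp [h]
  map_add' a b := by
    set u := Additive.toMul a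
    set v := Additive.toMul b
    have h₁ : (↑(u * v)⁻¹ : holFun E U) * u = ↑v⁻¹ := by
      rw [mul_inv, Units.val_mul, mul_right_comm, Units.inv_mul, one_mul]
    have h₂ : (↑(u * v)⁻¹ : holFun E U) * v = ↑u⁻¹ := by
      rw [mul_inv, Units.val_mul, mul_assoc, Units.inv_mul, mul_one]
    rw [toMul_add, Units.val_mul, dForm_mul, smul_add, smul_smul, smul_smul, h₁, h₂, add_comm]

end Forms

section LineBundles

variable (E : Type*) [NormedAddCommGroup E] [NormedSpace ℂ E]
  (X : Type*) [TopologicalSpace X] [ChartedSpace E X]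

/-- A holomorphic line bundle on `X`: a complex vector bundle with fibre `ℂ` and holomorphic
(complex analytic) transition functions. -/
structure LineBundle where
  fiber : X → Type
  [addCommGroup : ∀ x, AddCommGroup (fiber x)]
  [module : ∀ x, Module ℂ (fiber x)]
  [topFiber : ∀ x, TopologicalSpace (fiber x)]
  [isTopologicalAddGroup : ∀ x, IsTopologicalAddGroup (fiber x)]
  [continuousSMul : ∀ x, ContinuousSMul ℂ (fiber x)]
  [topTotal : TopologicalSpace (TotalSpace ℂ fiber)]
  [fiberBundle : FiberBundle ℂ fiber]
  [vectorBundle : VectorBundle ℂ ℂ fiber]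
  [holomorphic : ContMDiffVectorBundle ω ℂ fiber 𝓘(ℂ, E)]

attribute [instance] LineBundle.addCommGroup LineBundle.module LineBundle.topFiber
  LineBundle.isTopologicalAddGroup LineBundle.continuousSMul LineBundle.topTotal
  LineBundle.fiberBundle LineBundle.vectorBundle LineBundle.holomorphic

variable {E X}

namespace LineBundle

/-- The sheaf of holomorphic sections of a line bundle, an invertible `𝒪`-module. -/
abbrev sec (L : LineBundle E X) (U : Opens X) : Type _ := HolSec E ℂ L.fiber U

/-- An isomorphism of holomorphic line bundles: a family of linear isomorphisms of the fibres which
carries holomorphic sections to holomorphic sections, in both directions. -/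
structure Iso (L M : LineBundle E X) where
  equiv : ∀ x, L.fiber x ≃ₗ[ℂ] M.fiber x
  map_mem : ∀ (U : Opens X) (s : L.sec U), (fun x : U => equiv x (s.1 x)) ∈ holSec E ℂ M.fiber U
  symm_mem : ∀ (U : Opens X) (s : M.sec U), (fun x : U => (equiv x).symm (s.1 x)) ∈ holSec E ℂ L.fiber U

/-- The map on sections induced by an isomorphism. -/
def Iso.map {L M : LineBundle E X} (φ : Iso L M) {U : Opens X} (s : L.sec U) : M.sec U :=
  ⟨fun x => φ.equiv x (s.1 x), φ.map_mem U s⟩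

/-- `L` and `M` are isomorphic. -/
instance setoid : Setoid (LineBundle E X) where
  r L M := Nonempty (Iso L M)
  iseqv :=
    { refl := fun _ => ⟨⟨fun _ => .refl ℂ _, fun _ s => s.2, fun _ s => s.2⟩⟩
      symm := fun ⟨φ⟩ => ⟨⟨fun x => (φ.equiv x).symm, φ.symm_mem, φ.map_mem⟩⟩
      trans := fun ⟨φ⟩ ⟨ψ⟩ => ⟨⟨fun x => (φ.equiv x).trans (ψ.equiv x),
        fun U s => ψ.map_mem U ⟨_, φ.map_mem U s⟩, fun U s => φ.symm_mem U ⟨_, ψ.symm_mem U s⟩⟩⟩ }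

/-- `N`, together with the pairing `(s, t) ↦ s ⊗ t`, is a tensor product of the line bundles `L` and
`M`: each fibre of `N` is the tensor product of the fibres of `L` and `M`, and `s ⊗ t` is
holomorphic for holomorphic sections `s` and `t`. -/
structure TensorProduct (L M N : LineBundle E X) where
  pair : ∀ x, L.fiber x →ₗ[ℂ] M.fiber x →ₗ[ℂ] N.fiber x
  isTensorProduct : ∀ x, IsTensorProduct (pair x)
  pair_mem : ∀ (U : Opens X) (s : L.sec U) (t : M.sec U),
    (fun x : U => pair x (s.1 x) (t.1 x)) ∈ holSec E ℂ N.fiber U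

/-- The section `s ⊗ t` of the tensor product. -/
def TensorProduct.tmul {L M N : LineBundle E X} (τ : TensorProduct L M N) {U : Opens X}
    (s : L.sec U) (t : M.sec U) : N.sec U :=
  ⟨fun x => τ.pair x (s.1 x) (t.1 x), τ.pair_mem U s t⟩

variable (E X) in
/-- The trivial line bundle, whose sheaf of sections is `𝒪_X`. -/
abbrev trivial : LineBundle E X where
  fiber := Bundle.Trivial X ℂ

end LineBundle

variable (E X) in
/-- The analytic Picard group, as the set of isomorphism classes of holomorphic line bundles. -/
def PicAn := Quotient (LineBundle.setoid (E := E) (X := X))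

/-- The class of a line bundle. -/
def LineBundle.cls (L : LineBundle E X) : PicAn E X := Quotient.mk _ L

variable [IsManifold 𝓘(ℂ, E) ω X]

/-- The module `(Ω¹ ⊗ L)(U)` of holomorphic sections over `U` of the bundle
`T^*X ⊗ L = Hom(TX, L)`. -/
abbrev LineBundle.form (L : LineBundle E X) (U : Opens X) : Type _ :=
  HolSec E (E →L[ℂ] ℂ) (fun x : X => TangentSpace 𝓘(ℂ, E) x →L[ℂ] L.fiber x) U

/-- A holomorphic connection on `L`: a `ℂ`-linear morphism of sheaves `∇ : L → Ω¹ ⊗ L` with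
`∇ (f s) = f ∇ s + df ⊗ s`. The value at `x` of `η ⊗ s` is the linear map `v ↦ η x v • s x`. -/
structure Connection (L : LineBundle E X) where
  nabla : ∀ U : Opens X, L.sec U →ₗ[ℂ] L.form U
  nabla_res : ∀ {U W : Opens X} (h : W ≤ U) (s : L.sec U),
    nabla W (HolSec.res h s) = HolSec.res h (nabla U s)
  leibniz : ∀ {U : Opens X} (f : holFun E U) (s : L.sec U) (x : U)
    (v : TangentSpace 𝓘(ℂ, E) (x : X)),
    (nabla U (f • s)).1 x v = f.1 x • (nabla U s).1 x v + ((dForm f).1 x v : ℂ) • s.1 x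

variable (E X) in
/-- A holomorphic line bundle with a holomorphic connection. -/
structure ConnLineBundle where
  bundle : LineBundle E X
  conn : Connection bundle

namespace ConnLineBundle

/-- An isomorphism of line bundles with connection: an isomorphism `φ` of line bundles with
`∇' (φ s) = (1 ⊗ φ) (∇ s)`. -/
structure Iso (P Q : ConnLineBundle E X) where
  toIso : LineBundle.Iso P.bundle Q.bundle
  comm : ∀ (U : Opens X) (s : P.bundle.sec U) (x : U) (v : TangentSpace 𝓘(ℂ, E) (x : X)),
    (Q.conn.nabla U (toIso.map s)).1 x v = toIso.equiv x ((P.conn.nabla U s).1 x v)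

/-- `P` and `Q` are isomorphic. -/
instance setoid : Setoid (ConnLineBundle E X) where
  r P Q := Nonempty (Iso P Q)
  iseqv :=
    { refl := fun _ => ⟨⟨⟨fun _ => .refl ℂ _, fun _ s => s.2, fun _ s => s.2⟩, fun _ _ _ _ => rfl⟩⟩
      symm := fun {P Q} ⟨φ⟩ => ⟨⟨⟨fun x => (φ.toIso.equiv x).symm, φ.toIso.symm_mem,
        φ.toIso.map_mem⟩, fun U s x v => by
          have h := φ.comm U ⟨_, φ.toIso.symm_mem U s⟩ x v
          have h' : φ.toIso.map ⟨_, φ.toIso.symm_mem U s⟩ = s := by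
            ext y
            simp [LineBundle.Iso.map]
          rw [h'] at h
          rw [h, LinearEquiv.symm_apply_apply]
          rfl⟩⟩
      trans := fun ⟨φ⟩ ⟨ψ⟩ => ⟨⟨⟨fun x => (φ.toIso.equiv x).trans (ψ.toIso.equiv x),
        fun U s => ψ.toIso.map_mem U ⟨_, φ.toIso.map_mem U s⟩,
        fun U s => φ.toIso.symm_mem U ⟨_, ψ.toIso.symm_mem U s⟩⟩, fun U s x v => by
          have h := ψ.comm U (φ.toIso.map s) x v
          rw [φ.comm U s x v] at h
          exact h⟩⟩ }

/-- `R` is a tensor product of `P` and `Q`: the underlying line bundle is a tensor product, and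
`∇ (s ⊗ t) = ∇ s ⊗ t + s ⊗ ∇ t`. -/
structure TensorProduct (P Q R : ConnLineBundle E X) where
  toTensorProduct : LineBundle.TensorProduct P.bundle Q.bundle R.bundle
  nabla_tmul : ∀ (U : Opens X) (s : P.bundle.sec U) (t : Q.bundle.sec U) (x : U)
    (v : TangentSpace 𝓘(ℂ, E) (x : X)),
    (R.conn.nabla U (toTensorProduct.tmul s t)).1 x v =
      toTensorProduct.pair x ((P.conn.nabla U s).1 x v) (t.1 x) +
        toTensorProduct.pair x (s.1 x) ((Q.conn.nabla U t).1 x v)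

end ConnLineBundle

variable (E X) in
/-- The group `Pic_c` of line bundles with connection, as the set of isomorphism classes. -/
def PicC := Quotient (ConnLineBundle.setoid (E := E) (X := X))

/-- The class of a line bundle with connection. -/
def ConnLineBundle.cls (P : ConnLineBundle E X) : PicC E X := Quotient.mk _ P

/-- Forgetting the connection. -/
def forgetConn : PicC E X → PicAn E X :=
  Quotient.map ConnLineBundle.bundle fun _ _ ⟨φ⟩ => ⟨φ.toIso⟩

/-- Sections of the trivial line bundle are holomorphic functions. -/
def trivialToFun {U : Opens X} (f : (LineBundle.trivial E X).sec U) : holFun E U :=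
  ⟨f.1, by
    obtain ⟨t, ht, e⟩ := f.2
    refine ⟨t, fun x hx => ?_, e⟩
    exact (Bundle.contMDiffWithinAt_section (F := ℂ) (E := Bundle.Trivial X ℂ) ..).1 (ht x hx)⟩

theorem trivial_leibniz {U : Opens X} (η : holForm E U) (f g : holFun E U) (x : U)
    (v : TangentSpace 𝓘(ℂ, E) (x : X)) :
    ((dForm (f * g) + (f * g) • η).1 x v : ℂ) =
      f.1 x * (dForm g + g • η).1 x v + (dForm f).1 x v * g.1 x := by
  rw [dForm_mul, mul_smul]
  simp only [HolSec.add_apply, HolSec.smul_apply]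
  change f.1 x * (dForm g).1 x v + g.1 x * (dForm f).1 x v + f.1 x * (g.1 x * η.1 x v) =
    f.1 x * ((dForm g).1 x v + g.1 x * η.1 x v) + (dForm f).1 x v * g.1 x
  ring

/-- The connection `∇ f = df + f η` on the trivial line bundle. -/
def trivialConn (η : holForm E (⊤ : Opens X)) : Connection (LineBundle.trivial E X) where
  nabla U :=
    { toFun := fun f => dForm (trivialToFun f) + trivialToFun f • HolSec.res le_top η
      map_add' := fun f g => by
        have h : trivialToFun (f + g) = trivialToFun f + trivialToFun g := rfl
        rw [h, dForm_add, add_smul]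
        exact add_add_add_comm ..
      map_smul' := fun c f => by
        have h : trivialToFun (c • f) = algebraMap ℂ (holFun E U) c * trivialToFun f := rfl
        rw [h, dForm_mul, dForm_algebraMap, mul_smul, smul_zero, add_zero]
        exact (smul_add (algebraMap ℂ (holFun E U) c) _ _).symm }
  nabla_res := by
    intro U W h s
    have e : trivialToFun (HolSec.res h s) = holFun.res h (trivialToFun s) := rfl
    change dForm (trivialToFun (HolSec.res h s)) + trivialToFun (HolSec.res h s) • _ =
      HolSec.res h (dForm (trivialToFun s) + _)
    rw [map_add, e, dForm_res]
    rfl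
  leibniz := by
    intro U f s x v
    exact trivial_leibniz _ f (trivialToFun s) x v

/-- The map `H⁰(X, Ω¹) → Pic_c(X)`, `η ↦ (𝒪_X, d + η)`. -/
def formToPicC (η : holForm E (⊤ : Opens X)) : PicC E X :=
  ConnLineBundle.cls ⟨LineBundle.trivial E X, trivialConn η⟩

end LineBundles

section Cech

/-- An open covering `(U x)` of `X` indexed by the points of `X`, with `x ∈ U x`. Every open covering
is refined by one of these: choose for each point a member of the covering that contains it. -/
structure PointCover (X : Type*) [TopologicalSpace X] where
  toFun : X → Opens X
  mem : ∀ x, x ∈ toFun x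

/-- `𝒰 ≤ 𝒱` if `𝒱` refines `𝒰`. -/
instance (X : Type*) [TopologicalSpace X] : Preorder (PointCover X) where
  le 𝒰 𝒱 := ∀ x, 𝒱.toFun x ≤ 𝒰.toFun x
  le_refl _ _ := le_rfl
  le_trans _ _ _ h₁ h₂ x := (h₂ x).trans (h₁ x)

variable (E : Type*) [NormedAddCommGroup E] [NormedSpace ℂ E]
  {X : Type*} [TopologicalSpace X] [ChartedSpace E X]
  (F : Type*) [NormedAddCommGroup F] [NormedSpace ℂ F]
  (V : X → Type*) [TopologicalSpace (TotalSpace F V)] [∀ x, AddCommGroup (V x)]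
  [∀ x, Module ℂ (V x)] [∀ x, TopologicalSpace (V x)] [FiberBundle F V] [VectorBundle ℂ F V]

namespace PointCover

/-- The Čech `0`-cochains of `𝒰` with values in the sheaf of holomorphic sections of `V`. -/
abbrev C0 (𝒰 : PointCover X) : Type _ := ∀ i, HolSec E F V (𝒰.toFun i)

/-- The Čech `1`-cochains of `𝒰` with values in the sheaf of holomorphic sections of `V`. -/
abbrev C1 (𝒰 : PointCover X) : Type _ := ∀ i j, HolSec E F V (𝒰.toFun i ⊓ 𝒰.toFun j)

/-- The Čech coboundary `C⁰ → C¹`, `(b i) ↦ (b j - b i)`. -/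
def delta0 (𝒰 : PointCover X) : 𝒰.C0 E F V →+ 𝒰.C1 E F V where
  toFun b i j := HolSec.res inf_le_right (b j) - HolSec.res inf_le_left (b i)
  map_zero' := by
    funext i j
    simp
  map_add' b c := by
    funext i j
    simp only [Pi.add_apply, map_add]
    abel

/-- The Čech cocycles `Z¹`: `c j k - c i k + c i j = 0` on `U i ∩ U j ∩ U k`. -/
def Z1 (𝒰 : PointCover X) : AddSubgroup (𝒰.C1 E F V) where
  carrier := {c | ∀ i j k,
    HolSec.res (W := 𝒰.toFun i ⊓ 𝒰.toFun j ⊓ 𝒰.toFun k)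
        (le_inf (inf_le_left.trans inf_le_right) inf_le_right) (c j k) -
      HolSec.res (le_inf (inf_le_left.trans inf_le_left) inf_le_right) (c i k) +
      HolSec.res inf_le_left (c i j) = 0}
  zero_mem' i j k := by simp
  add_mem' {c d} hc hd i j k := by
    have h := congrArg₂ (· + ·) (hc i j k) (hd i j k)
    simp only [add_zero] at h
    rw [← h]
    simp only [Pi.add_apply, map_add]
    abel
  neg_mem' {c} hc i j k := by
    have h := congrArg (- ·) (hc i j k)
    simp only [neg_zero] at h
    rw [← h]
    simp only [Pi.neg_apply, map_neg]
    abel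

/-- The first Čech cohomology group of the covering `𝒰`: cocycles modulo coboundaries. -/
def H1 (𝒰 : PointCover X) : Type _ :=
  𝒰.Z1 E F V ⧸ (𝒰.delta0 E F V).range.addSubgroupOf (𝒰.Z1 E F V)

instance (𝒰 : PointCover X) : AddCommGroup (𝒰.H1 E F V) :=
  inferInstanceAs (AddCommGroup (𝒰.Z1 E F V ⧸ (𝒰.delta0 E F V).range.addSubgroupOf (𝒰.Z1 E F V)))

/-- The class of a cocycle in the first Čech cohomology group of the covering. -/
def toH1 (𝒰 : PointCover X) : 𝒰.Z1 E F V →+ 𝒰.H1 E F V :=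
  QuotientAddGroup.mk' ((𝒰.delta0 E F V).range.addSubgroupOf (𝒰.Z1 E F V))

/-- Restriction of cochains to a finer covering. -/
def resC1 {𝒰 𝒱 : PointCover X} (h : 𝒰 ≤ 𝒱) : 𝒰.C1 E F V →+ 𝒱.C1 E F V where
  toFun c i j := HolSec.res (inf_le_inf (h i) (h j)) (c i j)
  map_zero' := rfl
  map_add' _ _ := rfl

/-- Restriction of cocycles to a finer covering. -/
def resZ1 {𝒰 𝒱 : PointCover X} (h : 𝒰 ≤ 𝒱) : 𝒰.Z1 E F V →+ 𝒱.Z1 E F V :=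
  ((resC1 E F V h).comp (𝒰.Z1 E F V).subtype).codRestrict (𝒱.Z1 E F V) fun c i j k =>
    congrArg (HolSec.res (inf_le_inf (inf_le_inf (h i) (h j)) (h k))) (c.2 i j k)

/-- The refinement map on Čech cohomology. -/
def resH1 (𝒰 𝒱 : PointCover X) (h : 𝒰 ≤ 𝒱) : 𝒰.H1 E F V →+ 𝒱.H1 E F V :=
  QuotientAddGroup.map ((𝒰.delta0 E F V).range.addSubgroupOf (𝒰.Z1 E F V))
    ((𝒱.delta0 E F V).range.addSubgroupOf (𝒱.Z1 E F V)) (resZ1 E F V h) <| by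
    rintro ⟨c, hc⟩ ⟨b, hb⟩
    refine ⟨fun i => HolSec.res (h i) (b i), ?_⟩
    exact congrArg (resC1 E F V h) hb

end PointCover

open Classical in
/-- The first cohomology group of `X` with values in the sheaf of holomorphic sections of `V`:
the direct limit of the first Čech cohomology groups over all open coverings. -/
def SheafH1 : Type _ :=
  AddCommGroup.DirectLimit (fun 𝒰 : PointCover X => 𝒰.H1 E F V) (PointCover.resH1 E F V)

open Classical in
instance : AddCommGroup (SheafH1 E F V) :=
  inferInstanceAs (AddCommGroup
    (AddCommGroup.DirectLimit (fun 𝒰 : PointCover X => 𝒰.H1 E F V) (PointCover.resH1 E F V)))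

variable {E F V} in
open Classical in
/-- The class of a Čech cocycle. -/
def cechClass {𝒰 : PointCover X} (c : 𝒰.Z1 E F V) : SheafH1 E F V :=
  AddCommGroup.DirectLimit.of (fun 𝒰 : PointCover X => 𝒰.H1 E F V) (PointCover.resH1 E F V) 𝒰
    (𝒰.toH1 E F V c)

end Cech

section AtiyahClass

variable (E : Type*) [NormedAddCommGroup E] [NormedSpace ℂ E]
  (X : Type*) [TopologicalSpace X] [ChartedSpace E X] [IsManifold 𝓘(ℂ, E) ω X]

/-- The cohomology group `H¹(X, Ω¹)`. -/
abbrev H1Form : Type _ :=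
  SheafH1 E (E →L[ℂ] ℂ) (fun x : X => TangentSpace 𝓘(ℂ, E) x →L[ℂ] Bundle.Trivial X ℂ x)

variable {E X}

/-- The group of Čech cocycles `Z¹(𝒰, Ω¹)`. -/
abbrev Z1Form (𝒰 : PointCover X) :=
  𝒰.Z1 E (E →L[ℂ] ℂ) (fun x : X => TangentSpace 𝓘(ℂ, E) x →L[ℂ] Bundle.Trivial X ℂ x)

/-- Local trivializations of `L`: an open covering `(U i)`, nowhere vanishing holomorphic sections
`s i` of `L` over `U i`, and the transition functions `g i j` in `𝒪^*(U i ∩ U j)`, with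
`s j = g i j • s i` on `U i ∩ U j`. -/
structure LocalFrames (L : LineBundle E X) where
  cover : PointCover X
  frame : ∀ i, L.sec (cover.toFun i)
  frame_ne_zero : ∀ i x, (frame i).1 x ≠ 0
  trans : ∀ i j, (holFun E (cover.toFun i ⊓ cover.toFun j))ˣ
  frame_eq : ∀ i j, HolSec.res inf_le_right (frame j) =
    (trans i j : holFun E (cover.toFun i ⊓ cover.toFun j)) • HolSec.res inf_le_left (frame i)

/-- The Čech cochain `(dg_ij / g_ij)`. -/
def LocalFrames.dlogTrans {L : LineBundle E X} (T : LocalFrames L) (i j : X) :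
    holForm E (T.cover.toFun i ⊓ T.cover.toFun j) :=
  dlog _ (Additive.ofMul (T.trans i j))

end AtiyahClass

end HolLine

end

/-!
A nowhere vanishing holomorphic section of a line bundle is determined by any other one up to
multiplication by a unit, so local frames `s i` turn a line bundle into a Čech cocycle `g` with
values in `𝒪^*`, and the cocycle gives the bundle back. Writing `∇ (s i) = η i ⊗ s i`, a connection
becomes a cochain `η` with values in `Ω¹`; since replacing a frame `e` by `u • e` adds `dlog u` to
its connection form, the condition on `η` is `dlog g = δ η`. Tensor products correspond to sums of
the pairs `(g, η)`, which gives the group structures.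

In these terms the sequence reads `u ↦ dlog u`, `η ↦ (1, η)`, `(g, η) ↦ g`, `g ↦ [dlog g]`, and
exactness says the following: `(1, η)` is trivial iff a global frame with connection form `0` can be
rescaled to one with connection form `η`; the bundle of `(g, η)` is trivial iff it has a global
frame; and `dlog g` becomes a coboundary on a finer covering iff `g` can be completed to a pair
`(g, η)` there.
-/

noncomputable section

namespace HolLine

section DirectedPresentation

variable {ι : Type*} [Preorder ι] {G : ι → Type*} [∀ i, AddCommGroup (G i)]
  {f : ∀ i j, i ≤ j → G i →+ G j} {Q A : Type*} [AddCommGroup A]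

/-- A presentation of the set `Q` by a directed system of abelian groups: compatible and jointly
surjective maps `G i → Q` whose fibres are preserved by translations. It turns `Q` into a quotient
group of the direct limit, so that classes are added by adding representatives. -/
structure DirectedPresentation (f : ∀ i j, i ≤ j → G i →+ G j) (Q : Type*) where
  toFun : ∀ i, G i → Q
  map_res : ∀ {i j} (h : i ≤ j) (x : G i), toFun j (f i j h x) = toFun i x
  exists_rep : ∀ q, ∃ i x, toFun i x = q
  add_right_congr : ∀ {i} {x y : G i} (z : G i), toFun i x = toFun i y →
    toFun i (x + z) = toFun i (y + z)

namespace DirectedPresentation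

variable [IsDirectedOrder ι]

theorem exists_rep₂ (p : DirectedPresentation f Q) (q r : Q) :
    ∃ i x y, p.toFun i x = q ∧ p.toFun i y = r := by
  obtain ⟨i, x, rfl⟩ := p.exists_rep q
  obtain ⟨j, y, rfl⟩ := p.exists_rep r
  obtain ⟨k, hik, hjk⟩ := exists_ge_ge i j
  exact ⟨k, _, _, p.map_res hik x, p.map_res hjk y⟩

theorem hom_congr {p : DirectedPresentation f Q} {ψ : ∀ i, G i →+ A}
    (hres : ∀ {i j} (h : i ≤ j) (x : G i), ψ j (f i j h x) = ψ i x)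
    (hψ : ∀ {i} {x y : G i}, p.toFun i x = p.toFun i y → ψ i x = ψ i y) {i j : ι} {x : G i}
    {y : G j} (h : p.toFun i x = p.toFun j y) : ψ i x = ψ j y := by
  obtain ⟨k, hik, hjk⟩ := exists_ge_ge i j
  rw [← hres hik, ← hres hjk]
  exact hψ (by rw [p.map_res, p.map_res, h])

variable [DirectedSystem G (f · · ·)]

/-- The map from the direct limit onto the presented set. -/
def ofDirectLimit (p : DirectedPresentation f Q) : DirectLimit G f → Q :=
  DirectLimit.lift f p.toFun fun _ _ h x => (p.map_res h x).symm

theorem ofDirectLimit_surjective (p : DirectedPresentation f Q) :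
    Function.Surjective p.ofDirectLimit := fun q =>
  let ⟨i, x, hx⟩ := p.exists_rep q
  ⟨⟦⟨i, x⟩⟧, hx⟩

theorem ofDirectLimit_add_right_congr (p : DirectedPresentation f Q) {a b : DirectLimit G f}
    (c : DirectLimit G f) (h : p.ofDirectLimit a = p.ofDirectLimit b) :
    p.ofDirectLimit (a + c) = p.ofDirectLimit (b + c) := by
  induction a, b, c using DirectLimit.induction₃ with
  | _ i x y z =>
    rw [DirectLimit.add_def, DirectLimit.add_def]
    exact p.add_right_congr z h

/-- The congruence on the direct limit which identifies two elements with the same image. -/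
def addCon (p : DirectedPresentation f Q) : AddCon (DirectLimit G f) where
  toSetoid := Setoid.ker p.ofDirectLimit
  add' {a b c d} hab hcd := by
    rw [Setoid.ker_def] at hab hcd ⊢
    rw [p.ofDirectLimit_add_right_congr c hab, add_comm b, p.ofDirectLimit_add_right_congr b hcd,
      add_comm]

variable [Nonempty ι]

/-- The group structure on the presented set. -/
abbrev addCommGroup (p : DirectedPresentation f Q) : AddCommGroup Q :=
  letI : AddCommGroup (Quotient (Setoid.ker p.ofDirectLimit)) :=
    inferInstanceAs (AddCommGroup p.addCon.Quotient)
  (Setoid.quotientKerEquivOfSurjective _ p.ofDirectLimit_surjective).symm.addCommGroup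

theorem map_add (p : DirectedPresentation f Q) {i : ι} (x y : G i) :
    letI := p.addCommGroup
    p.toFun i (x + y) = p.toFun i x + p.toFun i y := by
  let e := Setoid.quotientKerEquivOfSurjective _ p.ofDirectLimit_surjective
  let mk (z : G i) : Quotient (Setoid.ker p.ofDirectLimit) := ⟦⟦⟨i, z⟩⟧⟧
  have he (z : G i) : e.symm (p.toFun i z) = mk z := e.symm_apply_eq.2 rfl
  let _ : Add (Quotient (Setoid.ker p.ofDirectLimit)) := inferInstanceAs (Add p.addCon.Quotient)
  have hadd : mk (x + y) = mk x + mk y :=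
    congrArg (Quotient.mk _) (DirectLimit.add_def (f := f) i x y).symm
  change _ = e (e.symm _ + e.symm _)
  rw [← e.symm_apply_eq, he, he, he, hadd]

/-- The homomorphism out of the presented group which is induced by the homomorphisms `ψ i`. -/
def lift (p : DirectedPresentation f Q) (ψ : ∀ i, G i →+ A)
    (hres : ∀ {i j} (h : i ≤ j) (x : G i), ψ j (f i j h x) = ψ i x)
    (hψ : ∀ {i} {x y : G i}, p.toFun i x = p.toFun i y → ψ i x = ψ i y) :
    letI := p.addCommGroup
    Q →+ A :=
  letI := p.addCommGroup
  AddMonoidHom.mk' (fun q => ψ _ (p.exists_rep q).choose_spec.choose) fun q r => by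
    obtain ⟨i, x, y, rfl, rfl⟩ := p.exists_rep₂ q r
    have h {j : ι} (z : G j) : ψ _ (p.exists_rep (p.toFun j z)).choose_spec.choose = ψ j z :=
      hom_congr hres hψ (p.exists_rep (p.toFun j z)).choose_spec.choose_spec
    rw [← p.map_add, h, h, h, _root_.map_add]

theorem lift_apply (p : DirectedPresentation f Q) (ψ : ∀ i, G i →+ A)
    (hres : ∀ {i j} (h : i ≤ j) (x : G i), ψ j (f i j h x) = ψ i x)
    (hψ : ∀ {i} {x y : G i}, p.toFun i x = p.toFun i y → ψ i x = ψ i y) {i : ι} (x : G i) :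
    letI := p.addCommGroup
    p.lift ψ hres hψ (p.toFun i x) = ψ i x :=
  hom_congr hres hψ (p.exists_rep (p.toFun i x)).choose_spec.choose_spec

end DirectedPresentation

end DirectedPresentation

section LocalCriteria

variable {E : Type*} [NormedAddCommGroup E] [NormedSpace ℂ E]
  {X : Type*} [TopologicalSpace X] [ChartedSpace E X]
  {F : Type*} [NormedAddCommGroup F] [NormedSpace ℂ F]
  {V : X → Type*} [TopologicalSpace (TotalSpace F V)] [∀ x, AddCommGroup (V x)]
  [∀ x, Module ℂ (V x)] [∀ x, TopologicalSpace (V x)] [FiberBundle F V] [VectorBundle ℂ F V]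
  {U W : Opens X}

theorem HolSec.exists_contMDiffAt (s : HolSec E F V U) :
    ∃ t : ∀ x, V x, (∀ x ∈ U, ContMDiffAt 𝓘(ℂ, E) (𝓘(ℂ, E).prod 𝓘(ℂ, F)) ω
      (fun x => TotalSpace.mk' F x (t x)) x) ∧ ∀ x (hx : x ∈ U), t x = s.1 ⟨x, hx⟩ := by
  obtain ⟨t, ht, hts⟩ := s.2
  exact ⟨t, fun x hx => ht.contMDiffAt (U.2.mem_nhds hx), fun x hx => hts ⟨x, hx⟩⟩

open Classical in
theorem mem_holSec_of_contMDiffAt {s : ∀ x : U, V x}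
    (h : ∀ x ∈ U, ∃ t : ∀ x, V x, ContMDiffAt 𝓘(ℂ, E) (𝓘(ℂ, E).prod 𝓘(ℂ, F)) ω
      (fun x => TotalSpace.mk' F x (t x)) x ∧ ∀ᶠ y in 𝓝 x, ∀ hy : y ∈ U, t y = s ⟨y, hy⟩) :
    s ∈ holSec E F V U := by
  refine ⟨fun x => if hx : x ∈ U then s ⟨x, hx⟩ else 0, fun x hx => ?_, fun x => by simp⟩
  obtain ⟨t, ht, hts⟩ := h x hx
  refine (ht.congr_of_eventuallyEq ?_).contMDiffWithinAt
  filter_upwards [hts, U.2.mem_nhds hx] with y hy hyU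
  rw [hy hyU, dif_pos (show y ∈ U from hyU)]

theorem mem_holSec_of_local {s : ∀ x : U, V x}
    (h : ∀ x ∈ U, ∃ W : Opens X, x ∈ W ∧ ∃ t : HolSec E F V W,
      ∀ y (hU : y ∈ U) (hW : y ∈ W), t.1 ⟨y, hW⟩ = s ⟨y, hU⟩) :
    s ∈ holSec E F V U := by
  refine mem_holSec_of_contMDiffAt fun x hx => ?_
  obtain ⟨W, hxW, t, ht⟩ := h x hx
  obtain ⟨t', ht', htt'⟩ := t.exists_contMDiffAt
  refine ⟨t', ht' x hxW, ?_⟩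
  filter_upwards [W.2.mem_nhds hxW] with y hy hyU
  rw [htt' y hy, ht y hyU hy]

theorem HolSec.res_smul (h : W ≤ U) (f : holFun E U) (s : HolSec E F V U) :
    HolSec.res h (f • s) = holFun.res h f • HolSec.res h s := rfl

theorem mem_holFun_of_contMDiffAt {f : U → ℂ}
    (h : ∀ x ∈ U, ∃ t : X → ℂ, ContMDiffAt 𝓘(ℂ, E) 𝓘(ℂ, ℂ) ω t x ∧
      ∀ᶠ y in 𝓝 x, ∀ hy : y ∈ U, t y = f ⟨y, hy⟩) :
    f ∈ holFun E U := by
  refine ⟨extendZero f, fun x hx => ?_, fun x => extendZero_apply f x⟩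
  obtain ⟨t, ht, htf⟩ := h x hx
  refine (ht.congr_of_eventuallyEq ?_).contMDiffWithinAt
  filter_upwards [htf, U.2.mem_nhds hx] with y hy hyU
  rw [hy hyU]
  exact extendZero_apply f ⟨y, hyU⟩

theorem unit_ne_zero (u : (holFun E U)ˣ) (x : U) : u.val.1 x ≠ 0 :=
  left_ne_zero_of_mul_eq_one (congrFun (congrArg Subtype.val u.mul_inv) x)

/-- Restriction of nowhere vanishing holomorphic functions, in additive notation. -/
def unitRes (h : W ≤ U) : Additive (holFun E U)ˣ →+ Additive (holFun E W)ˣ :=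
  (Units.map
    { toFun := holFun.res (E := E) h
      map_one' := rfl
      map_mul' := fun _ _ => rfl }).toAdditive

end LocalCriteria

namespace LineBundle

section Fibers

variable {E : Type*} [NormedAddCommGroup E] [NormedSpace ℂ E]
  {X : Type*} [TopologicalSpace X] [ChartedSpace E X] {L M N : LineBundle E X} {x : X}

/-- The coordinate on the fibre of `L` at `x` given by the preferred trivialization at `x`. -/
def coord (L : LineBundle E X) (x : X) : L.fiber x ≃L[ℂ] ℂ :=
  (trivializationAt ℂ L.fiber x).continuousLinearEquivAt ℂ x
    (mem_baseSet_trivializationAt ℂ L.fiber x)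

/-- The linear form on a fibre of `L` which takes the value `1` at the nonzero vector `e`; it is
zero for `e = 0`. -/
def ratio (e : L.fiber x) : L.fiber x →L[ℂ] ℂ :=
  (L.coord x e)⁻¹ • (L.coord x : L.fiber x →L[ℂ] ℂ)

theorem ratio_self {e : L.fiber x} (he : e ≠ 0) : ratio e e = 1 :=
  inv_mul_cancel₀ (by simpa using he)

theorem ratio_smul_self {e : L.fiber x} (he : e ≠ 0) (a : L.fiber x) : ratio e a • e = a := by
  apply (L.coord x).injective
  rw [map_smul, ratio, smul_apply, smul_eq_mul, smul_eq_mul, mul_right_comm,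
    inv_mul_cancel₀ (by simpa using he), one_mul]
  rfl

theorem linearMap_ext {R : Type*} [AddCommMonoid R] [Module ℂ R] {φ ψ : L.fiber x →ₗ[ℂ] R}
    {e : L.fiber x} (he : e ≠ 0) (h : φ e = ψ e) : φ = ψ := by
  ext a
  rw [← ratio_smul_self he a, map_smul, map_smul, h]

theorem bilinearMap_ext {R : Type*} [AddCommMonoid R] [Module ℂ R]
    {p q : L.fiber x →ₗ[ℂ] M.fiber x →ₗ[ℂ] R} {e : L.fiber x} {f : M.fiber x} (he : e ≠ 0)
    (hf : f ≠ 0) (h : p e f = q e f) : p = q :=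
  linearMap_ext he (linearMap_ext hf h)

/-- The isomorphism of fibres which carries `e` to `f`. -/
def fiberEquiv {e : L.fiber x} {f : M.fiber x} (he : e ≠ 0) (hf : f ≠ 0) :
    L.fiber x ≃ₗ[ℂ] M.fiber x :=
  .ofLinearMap ((ratio e : L.fiber x →ₗ[ℂ] ℂ).smulRight f)
    ((ratio f : M.fiber x →ₗ[ℂ] ℂ).smulRight e)
    (linearMap_ext hf <| by simp [ratio_self he, ratio_self hf])
    (linearMap_ext he <| by simp [ratio_self he, ratio_self hf])

theorem fiberEquiv_apply_self {e : L.fiber x} {f : M.fiber x} (he : e ≠ 0) (hf : f ≠ 0) :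
    fiberEquiv he hf e = f := by
  change ratio e e • f = f
  rw [ratio_self he, one_smul]

/-- The bilinear pairing of fibres which carries `(e, f)` to `n`. -/
def fiberPair (e : L.fiber x) (f : M.fiber x) (n : N.fiber x) :
    L.fiber x →ₗ[ℂ] M.fiber x →ₗ[ℂ] N.fiber x :=
  ((LinearMap.mul ℂ ℂ).compl₁₂ (ratio e : L.fiber x →ₗ[ℂ] ℂ) (ratio f : M.fiber x →ₗ[ℂ] ℂ)).compr₂
    (LinearMap.toSpanSingleton ℂ _ n)

theorem fiberPair_apply_self {e : L.fiber x} {f : M.fiber x} (he : e ≠ 0) (hf : f ≠ 0)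
    (n : N.fiber x) : fiberPair e f n e f = n := by
  simp [fiberPair, ratio_self he, ratio_self hf]

instance : FiniteDimensional ℂ (L.fiber x) :=
  (L.coord x).symm.toLinearEquiv.finiteDimensional

theorem finrank_fiber (L : LineBundle E X) (x : X) : Module.finrank ℂ (L.fiber x) = 1 := by
  rw [(L.coord x).toLinearEquiv.finrank_eq, Module.finrank_self]

theorem isTensorProduct_fiberPair {e : L.fiber x} {f : M.fiber x} {n : N.fiber x}
    (he : e ≠ 0) (hf : f ≠ 0) (hn : n ≠ 0) : IsTensorProduct (fiberPair e f n) := by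
  have hs : Function.Surjective (_root_.TensorProduct.lift (fiberPair e f n)) := fun b => by
    refine ⟨(ratio n b • e) ⊗ₜ[ℂ] f, ?_⟩
    rw [_root_.TensorProduct.lift.tmul, map_smul, LinearMap.smul_apply,
      fiberPair_apply_self he hf, ratio_smul_self hn]
  refine ⟨(LinearMap.injective_iff_surjective_of_finrank_eq_finrank ?_).2 hs, hs⟩
  rw [Module.finrank_tensorProduct, finrank_fiber, finrank_fiber, finrank_fiber]

theorem pair_ne_zero {p : L.fiber x →ₗ[ℂ] M.fiber x →ₗ[ℂ] N.fiber x} (hp : IsTensorProduct p)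
    {e : L.fiber x} {f : M.fiber x} (he : e ≠ 0) (hf : f ≠ 0) : p e f ≠ 0 := by
  intro h
  have hp₀ : p = 0 := bilinearMap_ext he hf h
  obtain ⟨z, hz⟩ := hp.2 ((N.coord x).symm 1)
  have hlift : _root_.TensorProduct.lift p = 0 := by
    rw [hp₀]
    exact _root_.TensorProduct.ext (by ext; simp)
  rw [hlift] at hz
  simpa using hz.symm

end Fibers

section Frames

variable {E : Type*} [NormedAddCommGroup E] [NormedSpace ℂ E]
  {X : Type*} [TopologicalSpace X] [ChartedSpace E X] {L : LineBundle E X} {U W : Opens X}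

theorem trivializationAt_ne_zero {x₀ x : X}
    (hx : x ∈ (trivializationAt ℂ L.fiber x₀).baseSet) {e : L.fiber x} (he : e ≠ 0) :
    (trivializationAt ℂ L.fiber x₀ ⟨x, e⟩).2 ≠ 0 := by
  change (trivializationAt ℂ L.fiber x₀).continuousLinearEquivAt ℂ x hx e ≠ 0
  rwa [Ne, EmbeddingLike.map_eq_zero_iff]

theorem trivializationAt_smul {x₀ x : X} (hx : x ∈ (trivializationAt ℂ L.fiber x₀).baseSet)
    (c : ℂ) (e : L.fiber x) : (trivializationAt ℂ L.fiber x₀ ⟨x, c • e⟩).2 =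
      c * (trivializationAt ℂ L.fiber x₀ ⟨x, e⟩).2 :=
  map_smul ((trivializationAt ℂ L.fiber x₀).continuousLinearEquivAt ℂ x hx) c e

/-- A holomorphic frame of `L` over `U`: a nowhere vanishing holomorphic section. -/
def IsFrame (e : L.sec U) : Prop := ∀ x, e.1 x ≠ 0

namespace IsFrame

variable {e f : L.sec U}

theorem res (he : IsFrame e) (h : W ≤ U) : IsFrame (HolSec.res h e) := fun x => he ⟨x, h x.2⟩

theorem unit_smul (he : IsFrame e) (u : (holFun E U)ˣ) : IsFrame (u • e) := fun x =>
  smul_ne_zero (unit_ne_zero u x) (he x)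

theorem smul_left_injective (he : IsFrame e) :
    Function.Injective fun a : holFun E U => a • e := fun _ _ h =>
  Subtype.ext <| funext fun x => _root_.smul_left_injective ℂ (he x) <|
    congrFun (congrArg Subtype.val h) x

theorem ratio_mem_holFun (he : IsFrame e) (s : L.sec U) :
    (fun x => ratio (e.1 x) (s.1 x)) ∈ holFun E U := by
  refine mem_holFun_of_contMDiffAt fun x hx => ?_
  obtain ⟨e', he', hee'⟩ := e.exists_contMDiffAt
  obtain ⟨s', hs', hss'⟩ := s.exists_contMDiffAt
  have hb := mem_baseSet_trivializationAt ℂ L.fiber x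
  have hde := (contMDiffAt_section x).1 (he' x hx)
  have hds := (contMDiffAt_section x).1 (hs' x hx)
  refine ⟨_, hds.mul (hde.inv₀ ?_), ?_⟩
  · rw [hee' x hx]
    exact trivializationAt_ne_zero hb (he ⟨x, hx⟩)
  · filter_upwards [(trivializationAt ℂ L.fiber x).open_baseSet.mem_nhds hb] with y hy hyU
    have hey := he ⟨y, hyU⟩
    rw [Pi.mul_apply, hss' y hyU, hee' y hyU, ← ratio_smul_self hey (s.1 ⟨y, hyU⟩),
      trivializationAt_smul hy, ratio_smul_self hey,
      mul_inv_cancel_right₀ (trivializationAt_ne_zero hy hey)]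

/-- The isomorphism `a ↦ a • e` of the structure sheaf with `L` given by a frame `e`. -/
def equiv (he : IsFrame e) : holFun E U ≃ₗ[holFun E U] L.sec U :=
  .ofBijective (LinearMap.toSpanSingleton _ _ e) ⟨he.smul_left_injective, fun s =>
    ⟨⟨_, he.ratio_mem_holFun s⟩, HolSec.ext fun x => ratio_smul_self (he x) _⟩⟩

theorem equiv_symm_smul (he : IsFrame e) (s : L.sec U) : he.equiv.symm s • e = s :=
  he.equiv.apply_symm_apply s

theorem equiv_symm_smul_self (he : IsFrame e) (a : holFun E U) : he.equiv.symm (a • e) = a :=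
  he.equiv.symm_apply_apply a

theorem exists_unit_smul_eq (he : IsFrame e) (hf : IsFrame f) :
    ∃ u : (holFun E U)ˣ, u • e = f := by
  have mul_eq_one {e f : L.sec U} (he : IsFrame e) (hf : IsFrame f) :
      hf.equiv.symm e * he.equiv.symm f = 1 := he.smul_left_injective <| by
    simp only [one_smul, mul_smul, equiv_symm_smul]
  exact ⟨⟨he.equiv.symm f, hf.equiv.symm e, mul_eq_one hf he, mul_eq_one he hf⟩,
    he.equiv_symm_smul f⟩

theorem unit_smul_injective (he : IsFrame e) :
    Function.Injective fun u : (holFun E U)ˣ => u • e := fun _ _ h =>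
  Units.ext (he.smul_left_injective h)

end IsFrame

theorem exists_isFrame (L : LineBundle E X) (x : X) :
    ∃ U : Opens X, x ∈ U ∧ ∃ e : L.sec U, IsFrame e := by
  set T := trivializationAt ℂ L.fiber x
  have hT {y} (hy : y ∈ T.baseSet) : T ⟨y, T.symm y 1⟩ = (y, (1 : ℂ)) := T.apply_mk_symm hy 1
  refine ⟨⟨T.baseSet, T.open_baseSet⟩, mem_baseSet_trivializationAt ℂ L.fiber x,
    ⟨fun y => T.symm y 1, fun y => T.symm y 1, fun y hy => ?_, fun _ => rfl⟩, fun y h => ?_⟩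
  · refine ContMDiffAt.contMDiffWithinAt ((T.contMDiffAt_section_iff hy).2 ?_)
    refine (contMDiffAt_const (c := (1 : ℂ))).congr_of_eventuallyEq ?_
    filter_upwards [T.open_baseSet.mem_nhds hy] with z hz
    rw [hT hz]
  · have hzero : (T ⟨y, 0⟩).2 = 0 := congrArg Prod.snd (T.zeroSection ℂ y.2)
    have hone : (T ⟨y, T.symm y 1⟩).2 = 1 := congrArg Prod.snd (hT y.2)
    exact one_ne_zero (hone.symm.trans ((congrArg (fun a => (T ⟨y, a⟩).2) h).trans hzero))

end Frames

end LineBundle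

section FormTensor

variable {E : Type*} [NormedAddCommGroup E] [NormedSpace ℂ E]
  {X : Type*} [TopologicalSpace X] [ChartedSpace E X] [IsManifold 𝓘(ℂ, E) ω X]
  {L : LineBundle E X} {U W : Opens X}

theorem dForm_unit (u : (holFun E U)ˣ) : dForm (u : holFun E U) = u • dlog U (.ofMul u) :=
  (smul_inv_smul u (dForm (u : holFun E U))).symm

theorem dForm_one : dForm (1 : holFun E U) = 0 := by
  simpa using dForm_algebraMap (E := E) (U := U) 1

theorem dlog_unitRes (h : W ≤ U) (u : Additive (holFun E U)ˣ) :
    dlog W (unitRes h u) = HolSec.res h (dlog U u) := by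
  change holFun.res h (↑u.toMul⁻¹ : holFun E U) • dForm (holFun.res h (u.toMul : holFun E U)) = _
  rw [dForm_res, ← HolSec.res_smul]
  rfl

namespace LineBundle

/-- The tensor `η ⊗ a` of a cotangent vector and a vector in the fibre of `L`. -/
def tensorAt {x : X} (η : TangentSpace 𝓘(ℂ, E) x →L[ℂ] Bundle.Trivial X ℂ x) (a : L.fiber x) :
    TangentSpace 𝓘(ℂ, E) x →L[ℂ] L.fiber x :=
  ContinuousLinearMap.smulRight (M₁ := TangentSpace 𝓘(ℂ, E) x) (M₂ := L.fiber x) (c := η) a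

theorem inCoordinates_tensorAt {x₀ x : X}
    (hx : x ∈ (trivializationAt ℂ L.fiber x₀).baseSet)
    (η : TangentSpace 𝓘(ℂ, E) x →L[ℂ] Bundle.Trivial X ℂ x) (a : L.fiber x) :
    ContinuousLinearMap.inCoordinates E (TangentSpace 𝓘(ℂ, E)) ℂ L.fiber x₀ x x₀ x
        (tensorAt η a) =
      (trivializationAt ℂ L.fiber x₀ ⟨x, a⟩).2 •
        ContinuousLinearMap.inCoordinates E (TangentSpace 𝓘(ℂ, E)) ℂ (Bundle.Trivial X ℂ)
          x₀ x x₀ x η := by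
  ext v
  set w := (trivializationAt E (TangentSpace 𝓘(ℂ, E)) x₀).symmL ℂ x v
  have hη : ContinuousLinearMap.inCoordinates E (TangentSpace 𝓘(ℂ, E)) ℂ (Bundle.Trivial X ℂ)
      x₀ x x₀ x η v = η w := by
    simp [ContinuousLinearMap.inCoordinates, w]
  rw [smul_apply, hη]
  change (trivializationAt ℂ L.fiber x₀).continuousLinearMapAt ℂ x ((η w : ℂ) • a) =
    (trivializationAt ℂ L.fiber x₀ ⟨x, a⟩).2 * (η w : ℂ)
  rw [map_smul, Trivialization.continuousLinearMapAt_apply,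
    Trivialization.linearMapAt_apply, if_pos hx, smul_eq_mul, mul_comm]

section Regularity

variable {η : ∀ x : X, TangentSpace 𝓘(ℂ, E) x →L[ℂ] Bundle.Trivial X ℂ x}
  {a : ∀ x, L.fiber x} {x : X}

theorem contMDiffAt_tensorAt
    (hη : ContMDiffAt 𝓘(ℂ, E) (𝓘(ℂ, E).prod 𝓘(ℂ, E →L[ℂ] ℂ)) ω
      (fun y => TotalSpace.mk' (E →L[ℂ] ℂ) y (η y)) x)
    (ha : ContMDiffAt 𝓘(ℂ, E) (𝓘(ℂ, E).prod 𝓘(ℂ, ℂ)) ω (fun y => TotalSpace.mk' ℂ y (a y)) x) :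
    ContMDiffAt 𝓘(ℂ, E) (𝓘(ℂ, E).prod 𝓘(ℂ, E →L[ℂ] ℂ)) ω
      (fun y => TotalSpace.mk' (E →L[ℂ] ℂ) y (tensorAt (η y) (a y))) x := by
  rw [contMDiffAt_hom_bundle] at hη ⊢
  refine ⟨contMDiffAt_id, (((contMDiffAt_section x).1 ha).smul hη.2).congr_of_eventuallyEq ?_⟩
  filter_upwards [(trivializationAt ℂ L.fiber x).open_baseSet.mem_nhds
    (mem_baseSet_trivializationAt ℂ L.fiber x)] with y hy
  exact inCoordinates_tensorAt hy (η y) (a y)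

theorem contMDiffAt_of_tensorAt (ha₀ : ∀ᶠ y in 𝓝 x, a y ≠ 0)
    (ha : ContMDiffAt 𝓘(ℂ, E) (𝓘(ℂ, E).prod 𝓘(ℂ, ℂ)) ω (fun y => TotalSpace.mk' ℂ y (a y)) x)
    (hηa : ContMDiffAt 𝓘(ℂ, E) (𝓘(ℂ, E).prod 𝓘(ℂ, E →L[ℂ] ℂ)) ω
      (fun y => TotalSpace.mk' (E →L[ℂ] ℂ) y (tensorAt (η y) (a y))) x) :
    ContMDiffAt 𝓘(ℂ, E) (𝓘(ℂ, E).prod 𝓘(ℂ, E →L[ℂ] ℂ)) ω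
      (fun y => TotalSpace.mk' (E →L[ℂ] ℂ) y (η y)) x := by
  have hb := mem_baseSet_trivializationAt ℂ L.fiber x
  rw [contMDiffAt_hom_bundle] at hηa ⊢
  refine ⟨contMDiffAt_id, ((((contMDiffAt_section x).1 ha).inv₀
    (trivializationAt_ne_zero hb ha₀.self_of_nhds)).smul hηa.2).congr_of_eventuallyEq ?_⟩
  filter_upwards [(trivializationAt ℂ L.fiber x).open_baseSet.mem_nhds hb, ha₀] with y hy hay
  refine (inv_smul_smul₀ (trivializationAt_ne_zero hy hay) _).symm.trans ?_
  exact congrArg (_ • ·) (inCoordinates_tensorAt hy (η y) (a y)).symm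

end Regularity

theorem form_ext {θ ζ : L.form U}
    (h : ∀ (x : U) (v : TangentSpace 𝓘(ℂ, E) (x : X)), θ.1 x v = ζ.1 x v) : θ = ζ :=
  HolSec.ext fun x => ContinuousLinearMap.ext (h x)

/-- The map `η ↦ η ⊗ a` from `1`-forms to `Ω¹ ⊗ L` given by a section `a` of `L`. -/
def formTensor (a : L.sec U) : holForm E U →ₗ[holFun E U] L.form U where
  toFun η := ⟨fun x => tensorAt (η.1 x) (a.1 x), mem_holSec_of_contMDiffAt fun x hx => by
    obtain ⟨η', hη', hηη'⟩ := η.exists_contMDiffAt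
    obtain ⟨a', ha', haa'⟩ := a.exists_contMDiffAt
    refine ⟨_, contMDiffAt_tensorAt (hη' x hx) (ha' x hx), .of_forall fun y hy => ?_⟩
    rw [hηη' y hy, haa' y hy]⟩
  map_add' η θ := form_ext fun x v => add_smul (η.1 x v : ℂ) (θ.1 x v : ℂ) (a.1 x)
  map_smul' f η := form_ext fun x v => mul_smul (f.1 x) (η.1 x v : ℂ) (a.1 x)

theorem formTensor_apply (a : L.sec U) (η : holForm E U) (x : U)
    (v : TangentSpace 𝓘(ℂ, E) (x : X)) :
    (formTensor a η).1 x v = (η.1 x v : ℂ) • a.1 x := rfl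

theorem formTensor_smul (f : holFun E U) (a : L.sec U) (η : holForm E U) :
    formTensor (f • a) η = f • formTensor a η :=
  form_ext fun x v => smul_comm (η.1 x v : ℂ) (f.1 x) (a.1 x)

theorem formTensor_unit_smul (u : (holFun E U)ˣ) (a : L.sec U) (η : holForm E U) :
    formTensor (u • a) (η + dlog U (.ofMul u)) =
      u • formTensor a η + formTensor a (dForm (u : holFun E U)) := by
  rw [Units.smul_def, formTensor_smul, map_add, smul_add, ← map_smul _ (u : holFun E U) (dlog U _),
    dForm_unit]
  rfl

namespace IsFrame

variable {e : L.sec U}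

theorem formTensor_injective (he : IsFrame e) :
    Function.Injective (formTensor (E := E) e) := fun _ _ h =>
  HolSec.ext fun x => ContinuousLinearMap.ext fun v => _root_.smul_left_injective ℂ (he x) <|
    DFunLike.congr_fun (congrFun (congrArg Subtype.val h) x) v

theorem exists_formTensor_eq (he : IsFrame e) (θ : L.form U) :
    ∃ η, formTensor e η = θ := by
  refine ⟨⟨fun x => (ratio (e.1 x)).comp (θ.1 x), mem_holSec_of_contMDiffAt fun x hx => ?_⟩,
    form_ext fun x v => ratio_smul_self (he x) _⟩
  obtain ⟨θ', hθ', hθθ'⟩ := θ.exists_contMDiffAt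
  obtain ⟨e', he', hee'⟩ := e.exists_contMDiffAt
  have he₀ {y} (hy : y ∈ U) : e' y ≠ 0 := by
    rw [hee' y hy]
    exact he _
  refine ⟨fun y => (ratio (e' y)).comp (θ' y), contMDiffAt_of_tensorAt (a := e') ?_ (he' x hx)
    ((hθ' x hx).congr_of_eventuallyEq ?_), .of_forall fun y hy => ?_⟩
  · filter_upwards [U.2.mem_nhds hx] with y hy using he₀ hy
  · filter_upwards [U.2.mem_nhds hx] with y hy
    exact congrArg (TotalSpace.mk' (E →L[ℂ] ℂ) y) <|
      ContinuousLinearMap.ext fun v => ratio_smul_self (he₀ hy) (θ' y v)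
  · exact congrArg₂ (fun (a : L.fiber y) (c : TangentSpace 𝓘(ℂ, E) y →L[ℂ] L.fiber y) =>
      (ratio a).comp c) (hee' y hy) (hθθ' y hy)

/-- The connection over `U` with `∇ e = η ⊗ e`. -/
def nabla (he : IsFrame e) (η : holForm E U) : L.sec U →ₗ[ℂ] L.form U where
  toFun s := formTensor e (dForm (he.equiv.symm s) + he.equiv.symm s • η)
  map_add' s t := by
    rw [map_add he.equiv.symm, dForm_add, add_smul, add_add_add_comm, map_add]
  map_smul' c s := by
    change formTensor e (dForm (he.equiv.symm (algebraMap ℂ (holFun E U) c • s)) +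
      he.equiv.symm (algebraMap ℂ (holFun E U) c • s) • η) = algebraMap ℂ (holFun E U) c • _
    rw [map_smul, smul_eq_mul, dForm_mul, dForm_algebraMap, smul_zero, add_zero, mul_smul,
      ← smul_add, map_smul]

theorem nabla_smul_self (he : IsFrame e) (η : holForm E U) (a : holFun E U) :
    he.nabla η (a • e) = formTensor e (dForm a + a • η) := by
  change formTensor e (dForm (he.equiv.symm (a • e)) + he.equiv.symm (a • e) • η) = _
  rw [he.equiv_symm_smul_self]

theorem nabla_self (he : IsFrame e) (η : holForm E U) : he.nabla η e = formTensor e η := by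
  have h := he.nabla_smul_self η 1
  rwa [one_smul, one_smul, dForm_one, zero_add] at h

theorem nabla_smul (he : IsFrame e) (η : holForm E U) (f : holFun E U) (s : L.sec U) :
    he.nabla η (f • s) = f • he.nabla η s + formTensor s (dForm f) := by
  obtain ⟨a, rfl⟩ := he.equiv.surjective s
  change he.nabla η (f • a • e) = f • he.nabla η (a • e) + formTensor (a • e) _
  rw [smul_smul, nabla_smul_self, nabla_smul_self, formTensor_smul, dForm_mul, mul_smul,
    ← map_smul, ← map_smul, ← map_add, smul_add]
  congr 1
  abel

theorem nabla_res (he : IsFrame e) (η : holForm E U) (h : W ≤ U) (s : L.sec U) :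
    (he.res h).nabla (HolSec.res h η) (HolSec.res h s) = HolSec.res h (he.nabla η s) := by
  obtain ⟨a, rfl⟩ := he.equiv.surjective s
  change (he.res h).nabla (HolSec.res h η) (holFun.res h a • HolSec.res h e) =
    HolSec.res h (he.nabla η (a • e))
  rw [nabla_smul_self, nabla_smul_self, dForm_res]
  rfl

theorem eq_nabla_of_leibniz (he : IsFrame e) {η : holForm E U} {D : L.sec U → L.form U}
    (hD : ∀ f s, D (f • s) = f • D s + formTensor s (dForm f)) (hDe : D e = formTensor e η)
    (s : L.sec U) : D s = he.nabla η s := by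
  obtain ⟨a, rfl⟩ := he.equiv.surjective s
  change D (a • e) = he.nabla η (a • e)
  rw [hD, hDe, nabla_smul, nabla_self]

theorem nabla_congr {f : L.sec U} (he : IsFrame e) (hf : IsFrame f) {η θ : holForm E U}
    {u : (holFun E U)ˣ} (hu : u • e = f) (hη : η + dlog U (.ofMul u) = θ) :
    hf.nabla θ = he.nabla η := by
  subst hu hη
  refine LinearMap.ext fun s => (eq_nabla_of_leibniz _ (he.nabla_smul η) ?_ s).symm
  rw [Units.smul_def, he.nabla_smul, nabla_self, ← Units.smul_def, ← Units.smul_def,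
    formTensor_unit_smul]

end IsFrame

end LineBundle

end FormTensor

section UnitCocycles

variable {X : Type*} [TopologicalSpace X]

namespace PointCover

/-- The common refinement of two coverings. -/
def inter (𝒰 𝒱 : PointCover X) : PointCover X :=
  ⟨fun x => 𝒰.toFun x ⊓ 𝒱.toFun x, fun x => ⟨𝒰.mem x, 𝒱.mem x⟩⟩

instance : IsDirectedOrder (PointCover X) :=
  ⟨fun 𝒰 𝒱 => ⟨𝒰.inter 𝒱, fun _ => inf_le_left, fun _ => inf_le_right⟩⟩

/-- The covering all of whose members are equal to `X`. -/
def whole (X : Type*) [TopologicalSpace X] : PointCover X := ⟨fun _ => ⊤, fun _ => trivial⟩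

instance : Nonempty (PointCover X) := ⟨whole X⟩

variable (E : Type*) [NormedAddCommGroup E] [NormedSpace ℂ E] [ChartedSpace E X]

/-- The Čech `1`-cochains of `𝒰` with values in `𝒪^*`, in additive notation. -/
abbrev UnitC1 (𝒰 : PointCover X) : Type _ := ∀ i j, Additive (holFun E (𝒰.toFun i ⊓ 𝒰.toFun j))ˣ

/-- The Čech cocycles `g i k = g i j * g j k` with values in `𝒪^*`, in additive notation. -/
def UnitZ1 (𝒰 : PointCover X) : AddSubgroup (𝒰.UnitC1 E) where
  carrier := {g | ∀ i j k,
    unitRes (W := 𝒰.toFun i ⊓ 𝒰.toFun j ⊓ 𝒰.toFun k)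
        (le_inf (inf_le_left.trans inf_le_left) inf_le_right) (g i k) =
      unitRes inf_le_left (g i j) +
        unitRes (le_inf (inf_le_left.trans inf_le_right) inf_le_right) (g j k)}
  zero_mem' i j k := by simp only [Pi.zero_apply, map_zero, add_zero]
  add_mem' {g h} hg hh i j k := by
    simp only [Pi.add_apply, map_add, hg i j k, hh i j k]
    abel
  neg_mem' {g} hg i j k := by
    simp only [Pi.neg_apply, map_neg, hg i j k, neg_add]

variable {E} {𝒰 𝒱 : PointCover X}

/-- Restriction of unit cocycles to a finer covering. -/
def resUnitZ1 (h : 𝒰 ≤ 𝒱) : 𝒰.UnitZ1 E →+ 𝒱.UnitZ1 E where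
  toFun g := ⟨fun i j => unitRes (inf_le_inf (h i) (h j)) (g.1 i j), fun i j k =>
    congrArg (unitRes (inf_le_inf (inf_le_inf (h i) (h j)) (h k))) (g.2 i j k)⟩
  map_zero' := rfl
  map_add' _ _ := rfl

instance : DirectedSystem (fun 𝒰 : PointCover X => 𝒰.UnitZ1 E)
    fun _ _ h => resUnitZ1 (E := E) h where
  map_self _ _ := rfl
  map_map _ _ _ _ _ _ := rfl

theorem UnitZ1.extendZero_mul (g : 𝒰.UnitZ1 E) {i j k x : X} (hi : x ∈ 𝒰.toFun i)
    (hj : x ∈ 𝒰.toFun j) (hk : x ∈ 𝒰.toFun k) :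
    extendZero (g.1 i k).toMul.val.1 x =
      extendZero (g.1 i j).toMul.val.1 x * extendZero (g.1 j k).toMul.val.1 x := by
  rw [extendZero_apply (g.1 i k).toMul.val.1 ⟨x, hi, hk⟩,
    extendZero_apply (g.1 i j).toMul.val.1 ⟨x, hi, hj⟩,
    extendZero_apply (g.1 j k).toMul.val.1 ⟨x, hj, hk⟩]
  exact congrFun (congrArg (fun u => u.toMul.val.1) (g.2 i j k)) ⟨x, ⟨hi, hj⟩, hk⟩

theorem UnitZ1.extendZero_ne_zero (g : 𝒰.UnitZ1 E) {i j x : X} (hi : x ∈ 𝒰.toFun i)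
    (hj : x ∈ 𝒰.toFun j) : extendZero (g.1 i j).toMul.val.1 x ≠ 0 := by
  rw [extendZero_apply (g.1 i j).toMul.val.1 ⟨x, hi, hj⟩]
  exact unit_ne_zero _ _

theorem UnitZ1.extendZero_self (g : 𝒰.UnitZ1 E) {i x : X} (hi : x ∈ 𝒰.toFun i) :
    extendZero (g.1 i i).toMul.val.1 x = 1 :=
  (mul_eq_left₀ (extendZero_ne_zero g hi hi)).1 (extendZero_mul g hi hi hi).symm

end PointCover

end UnitCocycles

namespace LineBundle

variable {E : Type*} [NormedAddCommGroup E] [NormedSpace ℂ E]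
  {X : Type*} [TopologicalSpace X] [ChartedSpace E X] {L M N : LineBundle E X}
  {𝒰 𝒱 : PointCover X} {U : Opens X}

/-- A framing of `L` over the covering `𝒰`: a frame over each member of the covering. -/
structure Framing (L : LineBundle E X) (𝒰 : PointCover X) where
  frame : ∀ i, L.sec (𝒰.toFun i)
  isFrame : ∀ i, IsFrame (frame i)

/-- Restriction of a framing to a finer covering. -/
def Framing.res (S : L.Framing 𝒰) (h : 𝒰 ≤ 𝒱) : L.Framing 𝒱 where
  frame i := HolSec.res (h i) (S.frame i)
  isFrame i := (S.isFrame i).res (h i)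

theorem exists_framing (L : LineBundle E X) : ∃ 𝒰, Nonempty (L.Framing 𝒰) := by
  choose U hU e he using L.exists_isFrame
  exact ⟨⟨U, hU⟩, ⟨⟨e, he⟩⟩⟩

theorem exists_framing₂ (L M : LineBundle E X) :
    ∃ 𝒰, Nonempty (L.Framing 𝒰) ∧ Nonempty (M.Framing 𝒰) := by
  obtain ⟨𝒰, ⟨S⟩⟩ := L.exists_framing
  obtain ⟨𝒱, ⟨T⟩⟩ := M.exists_framing
  obtain ⟨𝒲, h𝒰, h𝒱⟩ := exists_ge_ge 𝒰 𝒱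
  exact ⟨𝒲, ⟨S.res h𝒰⟩, ⟨T.res h𝒱⟩⟩

theorem Iso.map_smul (φ : Iso L M) (f : holFun E U) (s : L.sec U) : φ.map (f • s) = f • φ.map s :=
  HolSec.ext fun x => _root_.map_smul (φ.equiv x) (f.1 x) (s.1 x)

theorem TensorProduct.tmul_smul_smul (τ : TensorProduct L M N) (f g : holFun E U) (s : L.sec U)
    (t : M.sec U) : τ.tmul (f • s) (g • t) = (f * g) • τ.tmul s t := HolSec.ext fun x => by
  change τ.pair x (f.1 x • s.1 x) (g.1 x • t.1 x) = (f.1 x * g.1 x) • τ.pair x (s.1 x) (t.1 x)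
  rw [LinearMap.map_smul₂, _root_.map_smul, smul_smul]

theorem IsFrame.map {e : L.sec U} (he : IsFrame e) (φ : Iso L M) : IsFrame (φ.map e) := fun x =>
  (φ.equiv x).map_ne_zero_iff.2 (he x)

theorem IsFrame.tmul {e : L.sec U} {f : M.sec U} (he : IsFrame e) (hf : IsFrame f)
    (τ : TensorProduct L M N) : IsFrame (τ.tmul e f) := fun x =>
  pair_ne_zero (τ.isTensorProduct x) (he x) (hf x)

namespace Framing

/-- The transition functions of a framing. -/
def trans (S : L.Framing 𝒰) : 𝒰.UnitC1 E := fun i j =>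
  .ofMul (((S.isFrame i).res inf_le_left).exists_unit_smul_eq
    ((S.isFrame j).res inf_le_right)).choose

theorem trans_smul (S : L.Framing 𝒰) (i j : X) :
    (S.trans i j).toMul • HolSec.res inf_le_left (S.frame i) =
      HolSec.res inf_le_right (S.frame j) :=
  (((S.isFrame i).res inf_le_left).exists_unit_smul_eq ((S.isFrame j).res inf_le_right)).choose_spec

theorem trans_eq (S : L.Framing 𝒰) {i j : X} {u : (holFun E (𝒰.toFun i ⊓ 𝒰.toFun j))ˣ}
    (h : u • HolSec.res inf_le_left (S.frame i) = HolSec.res inf_le_right (S.frame j)) :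
    S.trans i j = .ofMul u :=
  ((S.isFrame i).res inf_le_left).unit_smul_injective ((S.trans_smul i j).trans h.symm)

theorem unitRes_trans_smul (S : L.Framing 𝒰) {i j : X} (h : U ≤ 𝒰.toFun i ⊓ 𝒰.toFun j) :
    (unitRes h (S.trans i j)).toMul • HolSec.res (h.trans inf_le_left) (S.frame i) =
      HolSec.res (h.trans inf_le_right) (S.frame j) :=
  congrArg (HolSec.res h) (S.trans_smul i j)

theorem trans_mem_unitZ1 (S : L.Framing 𝒰) : S.trans ∈ 𝒰.UnitZ1 E := fun i j k => by
  refine ((S.isFrame i).res (inf_le_left.trans inf_le_left)).unit_smul_injective ?_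
  change (unitRes _ _).toMul • _ = (unitRes _ _ + unitRes _ _).toMul • _
  rw [add_comm, toMul_add, mul_smul]
  refine (S.unitRes_trans_smul _).trans ?_
  exact (congrArg (_ • ·) (S.unitRes_trans_smul inf_le_left)).trans (S.unitRes_trans_smul _) |>.symm

/-- The cocycle of transition functions of a framing. -/
def cocycle (S : L.Framing 𝒰) : 𝒰.UnitZ1 E := ⟨S.trans, S.trans_mem_unitZ1⟩

theorem cocycle_res (S : L.Framing 𝒰) (h : 𝒰 ≤ 𝒱) :
    (S.res h).cocycle = PointCover.resUnitZ1 h S.cocycle :=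
  Subtype.ext <| funext₂ fun i j =>
    (S.res h).trans_eq (S.unitRes_trans_smul (inf_le_inf (h i) (h j)))

/-- Transport of a framing along an isomorphism. -/
def map (S : L.Framing 𝒰) (φ : Iso L M) : M.Framing 𝒰 where
  frame i := φ.map (S.frame i)
  isFrame i := (S.isFrame i).map φ

theorem cocycle_map (S : L.Framing 𝒰) (φ : Iso L M) : (S.map φ).cocycle = S.cocycle :=
  Subtype.ext <| funext₂ fun i j =>
    (S.map φ).trans_eq <| (φ.map_smul _ _).symm.trans (congrArg φ.map (S.trans_smul i j))

/-- The tensor product of two framings. -/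
def tmul (S : L.Framing 𝒰) (T : M.Framing 𝒰) (τ : TensorProduct L M N) : N.Framing 𝒰 where
  frame i := τ.tmul (S.frame i) (T.frame i)
  isFrame i := (S.isFrame i).tmul (T.isFrame i) τ

theorem cocycle_tmul (S : L.Framing 𝒰) (T : M.Framing 𝒰) (τ : TensorProduct L M N) :
    (S.tmul T τ).cocycle = S.cocycle + T.cocycle :=
  Subtype.ext <| funext₂ fun i j => (S.tmul T τ).trans_eq <| (τ.tmul_smul_smul _ _ _ _).symm.trans
    (congrArg₂ τ.tmul (S.trans_smul i j) (T.trans_smul i j))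

section MapMem

variable {φ : ∀ x, L.fiber x →ₗ[ℂ] M.fiber x} {p : ∀ x, L.fiber x →ₗ[ℂ] M.fiber x →ₗ[ℂ] N.fiber x}

theorem map_mem_holSec (S : L.Framing 𝒰) {t : ∀ i, M.sec (𝒰.toFun i)}
    (h : ∀ i (x : 𝒰.toFun i), φ x ((S.frame i).1 x) = (t i).1 x) (s : L.sec U) :
    (fun x : U => φ x (s.1 x)) ∈ holSec E ℂ M.fiber U := by
  refine mem_holSec_of_local fun x hx => ⟨U ⊓ 𝒰.toFun x, ⟨hx, 𝒰.mem x⟩, ?_⟩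
  obtain ⟨a, ha⟩ := ((S.isFrame x).res inf_le_right).equiv.surjective (HolSec.res inf_le_left s)
  refine ⟨a • HolSec.res inf_le_right (t x), fun y hU hW => ?_⟩
  rw [← show a.1 ⟨y, hW⟩ • (S.frame x).1 ⟨y, hW.2⟩ = s.1 ⟨y, hU⟩ from
    congrFun (congrArg Subtype.val ha) ⟨y, hW⟩, _root_.map_smul, h x ⟨y, hW.2⟩]
  rfl

theorem pair_mem_holSec (S : L.Framing 𝒰) (T : M.Framing 𝒰) {r : ∀ i, N.sec (𝒰.toFun i)}
    (h : ∀ i (x : 𝒰.toFun i), p x ((S.frame i).1 x) ((T.frame i).1 x) = (r i).1 x)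
    (s : L.sec U) (t : M.sec U) : (fun x : U => p x (s.1 x) (t.1 x)) ∈ holSec E ℂ N.fiber U := by
  refine mem_holSec_of_local fun x hx => ⟨U ⊓ 𝒰.toFun x, ⟨hx, 𝒰.mem x⟩, ?_⟩
  obtain ⟨a, ha⟩ := ((S.isFrame x).res inf_le_right).equiv.surjective (HolSec.res inf_le_left s)
  obtain ⟨b, hb⟩ := ((T.isFrame x).res inf_le_right).equiv.surjective (HolSec.res inf_le_left t)
  refine ⟨a • b • HolSec.res inf_le_right (r x), fun y hU hW => ?_⟩
  rw [← show a.1 ⟨y, hW⟩ • (S.frame x).1 ⟨y, hW.2⟩ = s.1 ⟨y, hU⟩ from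
      congrFun (congrArg Subtype.val ha) ⟨y, hW⟩,
    ← show b.1 ⟨y, hW⟩ • (T.frame x).1 ⟨y, hW.2⟩ = t.1 ⟨y, hU⟩ from
      congrFun (congrArg Subtype.val hb) ⟨y, hW⟩,
    LinearMap.map_smul₂, _root_.map_smul, h x ⟨y, hW.2⟩]
  rfl

end MapMem

theorem trans_smul_apply {S : L.Framing 𝒰} {g : 𝒰.UnitZ1 E} (h : S.cocycle = g) {i j x : X}
    (hi : x ∈ 𝒰.toFun i) (hj : x ∈ 𝒰.toFun j) :
    (g.1 i j).toMul.val.1 ⟨x, hi, hj⟩ • (S.frame i).1 ⟨x, hi⟩ = (S.frame j).1 ⟨x, hj⟩ := by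
  subst h
  exact congrFun (congrArg Subtype.val (S.trans_smul i j)) ⟨x, hi, hj⟩

/-- The isomorphisms of fibres given by two framings over the same covering. In the fibre at `x` the
frames with index `x` are used. -/
def frameEquiv (S : L.Framing 𝒰) (T : M.Framing 𝒰) (x : X) : L.fiber x ≃ₗ[ℂ] M.fiber x :=
  fiberEquiv (S.isFrame x ⟨x, 𝒰.mem x⟩) (T.isFrame x ⟨x, 𝒰.mem x⟩)

theorem frameEquiv_frame {S : L.Framing 𝒰} {T : M.Framing 𝒰} (h : S.cocycle = T.cocycle) (i : X)
    (x : 𝒰.toFun i) : S.frameEquiv T x ((S.frame i).1 x) = (T.frame i).1 x := by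
  rw [← trans_smul_apply h (𝒰.mem x) x.2, ← trans_smul_apply rfl (𝒰.mem x) x.2, _root_.map_smul,
    frameEquiv, fiberEquiv_apply_self]

/-- The isomorphism of line bundles which matches two framings with the same transition
functions. -/
def iso {S : L.Framing 𝒰} {T : M.Framing 𝒰} (h : S.cocycle = T.cocycle) : Iso L M where
  equiv := S.frameEquiv T
  map_mem _ := S.map_mem_holSec (M := M) (t := T.frame)
    (φ := fun x => (S.frameEquiv T x).toLinearMap) (frameEquiv_frame h)
  symm_mem _ := T.map_mem_holSec (M := L) (t := S.frame)
    (φ := fun x => (S.frameEquiv T x).symm.toLinearMap) fun i x =>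
      (S.frameEquiv T x).symm_apply_eq.2 (frameEquiv_frame h i x).symm

theorem iso_map_frame {S : L.Framing 𝒰} {T : M.Framing 𝒰} (h : S.cocycle = T.cocycle) (i : X) :
    (iso h).map (S.frame i) = T.frame i :=
  HolSec.ext (frameEquiv_frame h i)

/-- The pairings of fibres given by three framings over the same covering. In the fibre at `x` the
frames with index `x` are used. -/
def framePair (S : L.Framing 𝒰) (T : M.Framing 𝒰) (R : N.Framing 𝒰) (x : X) :
    L.fiber x →ₗ[ℂ] M.fiber x →ₗ[ℂ] N.fiber x :=
  fiberPair ((S.frame x).1 ⟨x, 𝒰.mem x⟩) ((T.frame x).1 ⟨x, 𝒰.mem x⟩) ((R.frame x).1 ⟨x, 𝒰.mem x⟩)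

theorem framePair_frame {S : L.Framing 𝒰} {T : M.Framing 𝒰} {R : N.Framing 𝒰}
    (h : R.cocycle = S.cocycle + T.cocycle) (i : X) (x : 𝒰.toFun i) :
    S.framePair T R x ((S.frame i).1 x) ((T.frame i).1 x) = (R.frame i).1 x := by
  rw [← trans_smul_apply h (𝒰.mem x) x.2, ← trans_smul_apply rfl (𝒰.mem x) x.2,
    ← trans_smul_apply rfl (𝒰.mem x) x.2, LinearMap.map_smul₂, _root_.map_smul, smul_smul,
    framePair, fiberPair_apply_self (S.isFrame _ _) (T.isFrame _ _)]
  rfl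

/-- The tensor product of line bundles given by framings whose transition functions multiply. -/
def tensorProduct {S : L.Framing 𝒰} {T : M.Framing 𝒰} {R : N.Framing 𝒰}
    (h : R.cocycle = S.cocycle + T.cocycle) : TensorProduct L M N where
  pair := S.framePair T R
  isTensorProduct x := isTensorProduct_fiberPair (S.isFrame x _) (T.isFrame x _) (R.isFrame x _)
  pair_mem _ := S.pair_mem_holSec T (framePair_frame h)

theorem tensorProduct_tmul_frame {S : L.Framing 𝒰} {T : M.Framing 𝒰} {R : N.Framing 𝒰}
    (h : R.cocycle = S.cocycle + T.cocycle) (i : X) :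
    (tensorProduct h).tmul (S.frame i) (T.frame i) = R.frame i :=
  HolSec.ext (framePair_frame h i)

end Framing

theorem nonempty_localFrames (L : LineBundle E X) : Nonempty (LocalFrames L) := by
  obtain ⟨𝒰, ⟨S⟩⟩ := L.exists_framing
  exact ⟨⟨𝒰, S.frame, S.isFrame, fun i j => (S.trans i j).toMul,
    fun i j => (S.trans_smul i j).symm⟩⟩

variable [IsManifold 𝓘(ℂ, E) ω X]

/-- The vector bundle core with transition functions `g`. -/
def cocycleCore (g : 𝒰.UnitZ1 E) : VectorBundleCore ℂ X ℂ X where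
  baseSet i := 𝒰.toFun i
  isOpen_baseSet i := (𝒰.toFun i).2
  indexAt x := x
  mem_baseSet_at := 𝒰.mem
  coordChange i j x := extendZero (g.1 j i).toMul.val.1 x • ContinuousLinearMap.id ℂ ℂ
  coordChange_self i x hx v := by
    rw [PointCover.UnitZ1.extendZero_self g hx, one_smul, ContinuousLinearMap.id_apply]
  continuousOn_coordChange i j := by
    rw [Set.inter_comm]
    exact (contMDiffOn_extendZero (E := E) (g.1 j i).toMul.val).continuousOn.smul
      continuousOn_const
  coordChange_comp i j k x hx v := by
    rw [PointCover.UnitZ1.extendZero_mul g hx.2 hx.1.2 hx.1.1, mul_smul]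
    rfl

instance (g : 𝒰.UnitZ1 E) : (cocycleCore g).IsContMDiff 𝓘(ℂ, E) ω where
  contMDiffOn_coordChange i j := by
    change ContMDiffOn _ _ _ _ ((𝒰.toFun i : Set X) ∩ 𝒰.toFun j)
    rw [Set.inter_comm]
    exact (contMDiffOn_extendZero (E := E) (g.1 j i).toMul.val).smul contMDiffOn_const

/-- The line bundle with transition functions `g`. -/
def ofCocycle (g : 𝒰.UnitZ1 E) : LineBundle E X where
  fiber := (cocycleCore g).Fiber
  isTopologicalAddGroup _ := inferInstanceAs (IsTopologicalAddGroup ℂ)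
  continuousSMul _ := inferInstanceAs (ContinuousSMul ℂ ℂ)

/-- The tautological frames of the line bundle with transition functions `g`. -/
def cocycleFraming (g : 𝒰.UnitZ1 E) : (ofCocycle g).Framing 𝒰 where
  frame i := ⟨fun x => (cocycleCore g).coordChange i x x 1,
    fun x => (cocycleCore g).coordChange i x x 1, fun x hx => by
      have : MemTrivializationAtlas ((cocycleCore g).localTriv i) := ⟨⟨i, rfl⟩⟩
      refine ContMDiffAt.contMDiffWithinAt <| (((cocycleCore g).localTriv i
        ).contMDiffAt_section_iff (IB := 𝓘(ℂ, E)) (n := ω) (E := (cocycleCore g).Fiber)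
        (s := fun x => (cocycleCore g).coordChange i x x 1) hx).2 ?_
      refine (contMDiffAt_const (c := (1 : ℂ))).congr_of_eventuallyEq ?_
      filter_upwards [(𝒰.toFun i).2.mem_nhds hx] with y hy
      change (cocycleCore g).coordChange y i y ((cocycleCore g).coordChange i y y 1) = 1
      rw [(cocycleCore g).coordChange_comp i y i y ⟨⟨hy, 𝒰.mem y⟩, hy⟩,
        (cocycleCore g).coordChange_self i y hy], fun _ => rfl⟩
  isFrame i x := by
    change extendZero (g.1 x i).toMul.val.1 x * (1 : ℂ) ≠ 0
    rw [mul_one]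
    exact PointCover.UnitZ1.extendZero_ne_zero g (𝒰.mem x) x.2

theorem cocycle_cocycleFraming (g : 𝒰.UnitZ1 E) : (cocycleFraming g).cocycle = g :=
  Subtype.ext <| funext₂ fun i j => (cocycleFraming g).trans_eq <| HolSec.ext fun x => by
    change (g.1 i j).toMul.val.1 x * (extendZero (g.1 x i).toMul.val.1 x * 1 : ℂ) =
      extendZero (g.1 x j).toMul.val.1 x * 1
    rw [← extendZero_apply (g.1 i j).toMul.val.1 x,
      PointCover.UnitZ1.extendZero_mul g (𝒰.mem x) x.2.1 x.2.2]
    ring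

theorem Framing.cls_ofCocycle (S : L.Framing 𝒰) {g : 𝒰.UnitZ1 E} (h : S.cocycle = g) :
    (ofCocycle g).cls = L.cls :=
  Quotient.sound ⟨Framing.iso ((cocycle_cocycleFraming g).trans h.symm)⟩

/-- The bundle with transition functions `g * h` is the tensor product of the bundles with
transition functions `g` and `h`. -/
def ofCocycleTensorProduct (g h : 𝒰.UnitZ1 E) :
    TensorProduct (ofCocycle g) (ofCocycle h) (ofCocycle (g + h)) :=
  Framing.tensorProduct <| (cocycle_cocycleFraming _).trans <|
    (congrArg₂ (· + ·) (cocycle_cocycleFraming g) (cocycle_cocycleFraming h)).symm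

end LineBundle

section Connections

variable {E : Type*} [NormedAddCommGroup E] [NormedSpace ℂ E]
  {X : Type*} [TopologicalSpace X] [ChartedSpace E X] [IsManifold 𝓘(ℂ, E) ω X]
  {L M N : LineBundle E X} {U W : Opens X}

open LineBundle

namespace Connection

/-- `η` is the connection form of `D` with respect to the section `e`, that is, `∇ e = η ⊗ e`. -/
def IsConnForm (D : Connection L) (e : L.sec U) (η : holForm E U) : Prop :=
  D.nabla U e = formTensor e η

theorem nabla_smul (D : Connection L) (f : holFun E U) (s : L.sec U) :
    D.nabla U (f • s) = f • D.nabla U s + formTensor s (dForm f) :=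
  form_ext (D.leibniz f s)

theorem nabla_res_apply (D : Connection L) (h : W ≤ U) (s : L.sec U) (x : W)
    (v : TangentSpace 𝓘(ℂ, E) (x : X)) :
    (D.nabla W (HolSec.res h s)).1 x v = (D.nabla U s).1 ⟨x, h x.2⟩ v := by
  rw [D.nabla_res]
  rfl

namespace IsConnForm

variable {D : Connection L} {D' : Connection M} {D'' : Connection N} {e : L.sec U} {f : M.sec U}
  {η θ : holForm E U}

theorem res (h : D.IsConnForm e η) (hW : W ≤ U) :
    D.IsConnForm (HolSec.res hW e) (HolSec.res hW η) :=
  (D.nabla_res hW e).trans (congrArg (HolSec.res hW) h)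

theorem unique (he : IsFrame e) (hη : D.IsConnForm e η) (hθ : D.IsConnForm e θ) : η = θ :=
  he.formTensor_injective (hη.symm.trans hθ)

theorem nabla_smul_self (h : D.IsConnForm e η) (a : holFun E U) :
    D.nabla U (a • e) = formTensor e (dForm a + a • η) := by
  rw [D.nabla_smul, show D.nabla U e = _ from h, map_add, map_smul, add_comm]

theorem unit_smul (h : D.IsConnForm e η) (u : (holFun E U)ˣ) :
    D.IsConnForm (u • e) (η + dlog U (.ofMul u)) := by
  rw [IsConnForm, formTensor_unit_smul, Units.smul_def, D.nabla_smul, show D.nabla U e = _ from h]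
  rfl

theorem iso_comm (he : IsFrame e) {φ : Iso L M} (h : D.IsConnForm e η)
    (hφ : D'.IsConnForm (φ.map e) η) (s : L.sec U) (x : U) (v : TangentSpace 𝓘(ℂ, E) (x : X)) :
    (D'.nabla U (φ.map s)).1 x v = φ.equiv x ((D.nabla U s).1 x v) := by
  obtain ⟨a, rfl⟩ := he.equiv.surjective s
  change (D'.nabla U (φ.map (a • e))).1 x v = φ.equiv x ((D.nabla U (a • e)).1 x v)
  rw [φ.map_smul, hφ.nabla_smul_self, h.nabla_smul_self, formTensor_apply, formTensor_apply,
    map_smul]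
  rfl

theorem nabla_tmul (he : IsFrame e) (hf : IsFrame f) {τ : LineBundle.TensorProduct L M N}
    (hη : D.IsConnForm e η) (hθ : D'.IsConnForm f θ) (hτ : D''.IsConnForm (τ.tmul e f) (η + θ))
    (s : L.sec U) (t : M.sec U) (x : U) (v : TangentSpace 𝓘(ℂ, E) (x : X)) :
    (D''.nabla U (τ.tmul s t)).1 x v =
      τ.pair x ((D.nabla U s).1 x v) (t.1 x) + τ.pair x (s.1 x) ((D'.nabla U t).1 x v) := by
  obtain ⟨a, rfl⟩ := he.equiv.surjective s
  obtain ⟨b, rfl⟩ := hf.equiv.surjective t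
  change (D''.nabla U (τ.tmul (a • e) (b • f))).1 x v =
    τ.pair x ((D.nabla U (a • e)).1 x v) (b.1 x • f.1 x) +
      τ.pair x (a.1 x • e.1 x) ((D'.nabla U (b • f)).1 x v)
  rw [τ.tmul_smul_smul, hτ.nabla_smul_self, hη.nabla_smul_self, hθ.nabla_smul_self, dForm_mul,
    formTensor_apply, formTensor_apply, formTensor_apply]
  have hpair (c d : ℂ) :
      τ.pair x (c • e.1 x) (d • f.1 x) = (c * d) • τ.pair x (e.1 x) (f.1 x) := by
    rw [LinearMap.map_smul₂, map_smul, smul_smul]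
  rw [hpair, hpair, ← add_smul]
  refine congrArg (· • τ.pair x (e.1 x) (f.1 x)) ?_
  change (a.1 x * (dForm b).1 x v + b.1 x * (dForm a).1 x v : ℂ) +
      a.1 x * b.1 x * (η.1 x v + θ.1 x v : ℂ) =
    ((dForm a).1 x v + a.1 x * η.1 x v : ℂ) * b.1 x +
      a.1 x * ((dForm b).1 x v + b.1 x * θ.1 x v : ℂ)
  ring

end IsConnForm

end Connection

namespace ConnLineBundle

variable {P Q R : ConnLineBundle E X} {e : P.bundle.sec U} {f : Q.bundle.sec U}
  {η θ : holForm E U}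

theorem Iso.isConnForm (φ : Iso P Q) (h : P.conn.IsConnForm e η) :
    Q.conn.IsConnForm (φ.toIso.map e) η := form_ext fun x v => by
  rw [φ.comm, show P.conn.nabla U e = _ from h, formTensor_apply, map_smul]
  rfl

theorem TensorProduct.isConnForm (τ : TensorProduct P Q R) (hη : P.conn.IsConnForm e η)
    (hθ : Q.conn.IsConnForm f θ) :
    R.conn.IsConnForm (τ.toTensorProduct.tmul e f) (η + θ) := form_ext fun x v => by
  rw [τ.nabla_tmul, show P.conn.nabla U e = _ from hη, show Q.conn.nabla U f = _ from hθ,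
    formTensor_apply, formTensor_apply, formTensor_apply, LinearMap.map_smul₂, map_smul,
    ← add_smul]
  rfl

end ConnLineBundle

theorem isConnForm_trivialConn (η : holForm E (⊤ : Opens X)) {e : (trivial E X).sec U}
    (he : ∀ x, e.1 x = (1 : ℂ)) : (trivialConn η).IsConnForm e (HolSec.res le_top η) := by
  have h : trivialToFun e = 1 := Subtype.ext (funext he)
  refine form_ext fun x v => ?_
  change (dForm (trivialToFun e) + trivialToFun e • HolSec.res le_top η).1 x v = _
  rw [h, dForm_one, zero_add, one_smul, formTensor_apply, he x]
  exact (mul_one _).symm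

end Connections

section ConnCocycles

variable {X : Type*} [TopologicalSpace X]

namespace PointCover

variable (E : Type*) [NormedAddCommGroup E] [NormedSpace ℂ E] [ChartedSpace E X]
  [IsManifold 𝓘(ℂ, E) ω X]

/-- The Čech `0`-cochains of `𝒰` with values in `Ω¹`. -/
abbrev C0Form (𝒰 : PointCover X) : Type _ :=
  𝒰.C0 E (E →L[ℂ] ℂ) (fun x : X => TangentSpace 𝓘(ℂ, E) x →L[ℂ] Bundle.Trivial X ℂ x)

instance (𝒰 : PointCover X) : AddCommGroup (𝒰.C0Form E) := Pi.addCommGroup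

/-- The Čech `1`-cochains of `𝒰` with values in `Ω¹`. -/
abbrev C1Form (𝒰 : PointCover X) : Type _ :=
  𝒰.C1 E (E →L[ℂ] ℂ) (fun x : X => TangentSpace 𝓘(ℂ, E) x →L[ℂ] Bundle.Trivial X ℂ x)

/-- The Čech coboundary of `0`-cochains with values in `Ω¹`. -/
abbrev deltaForm (𝒰 : PointCover X) : 𝒰.C0Form E →+ 𝒰.C1Form E := 𝒰.delta0 E _ _

/-- The logarithmic derivative of Čech cocycles. -/
def dlogZ1 (𝒰 : PointCover X) : 𝒰.UnitZ1 E →+ Z1Form (E := E) 𝒰 where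
  toFun g := ⟨fun i j => dlog _ (g.1 i j), fun i j k => by
    rw [← dlog_unitRes, ← dlog_unitRes, ← dlog_unitRes, g.2 i j k, map_add]
    abel⟩
  map_zero' := Subtype.ext <| funext₂ fun _ _ => map_zero _
  map_add' _ _ := Subtype.ext <| funext₂ fun _ _ => map_add _ _ _

/-- The hypercocycles of the complex `dlog : 𝒪^* → Ω¹`: pairs of a cocycle `g` with values in `𝒪^*`
and a cochain `η` with values in `Ω¹` such that `dlog g = δ η`. -/
def ConnZ1 (𝒰 : PointCover X) : AddSubgroup (𝒰.UnitZ1 E × 𝒰.C0Form E) where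
  carrier := {p | ∀ i j, dlog _ (p.1.1 i j) = 𝒰.deltaForm E p.2 i j}
  zero_mem' i j := (map_zero _).trans (congrFun₂ (map_zero (𝒰.deltaForm E)) i j).symm
  add_mem' {_ _} hp hq i j := (map_add _ _ _).trans <|
    (congrArg₂ (· + ·) (hp i j) (hq i j)).trans (congrFun₂ (map_add (𝒰.deltaForm E) _ _) i j).symm
  neg_mem' {_} hp i j := (map_neg _ _).trans <|
    (congrArg (- ·) (hp i j)).trans (congrFun₂ (map_neg (𝒰.deltaForm E) _) i j).symm

variable {E} {𝒰 𝒱 : PointCover X}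

/-- Restriction of hypercocycles to a finer covering. -/
def resConnZ1 (h : 𝒰 ≤ 𝒱) : 𝒰.ConnZ1 E →+ 𝒱.ConnZ1 E where
  toFun p := ⟨(resUnitZ1 h p.1.1, fun i => HolSec.res (h i) (p.1.2 i)), fun i j =>
    (dlog_unitRes _ _).trans (congrArg (HolSec.res (inf_le_inf (h i) (h j))) (p.2 i j))⟩
  map_zero' := rfl
  map_add' _ _ := rfl

instance : DirectedSystem (fun 𝒰 : PointCover X => 𝒰.ConnZ1 E)
    fun _ _ h => resConnZ1 (E := E) h where
  map_self _ _ := rfl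
  map_map _ _ _ _ _ _ := rfl

theorem ConnZ1.add_dlog (p : 𝒰.ConnZ1 E) {i j : X} {U : Opens X} (h : U ≤ 𝒰.toFun i ⊓ 𝒰.toFun j) :
    HolSec.res (h.trans inf_le_left) (p.1.2 i) + dlog U (unitRes h (p.1.1.1 i j)) =
      HolSec.res (h.trans inf_le_right) (p.1.2 j) := by
  have hp : dlog _ (p.1.1.1 i j) =
      HolSec.res inf_le_right (p.1.2 j) - HolSec.res inf_le_left (p.1.2 i) := p.2 i j
  rw [dlog_unitRes, hp, map_sub]
  exact add_sub_cancel _ _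

end PointCover

end ConnCocycles

namespace LineBundle.Framing

variable {E : Type*} [NormedAddCommGroup E] [NormedSpace ℂ E]
  {X : Type*} [TopologicalSpace X] [ChartedSpace E X] [IsManifold 𝓘(ℂ, E) ω X]
  {L : LineBundle E X} {𝒰 : PointCover X} {U W : Opens X}

/-- The connection forms of `D` with respect to a framing. -/
def connForm (S : L.Framing 𝒰) (D : Connection L) : 𝒰.C0Form E := fun i =>
  ((S.isFrame i).exists_formTensor_eq (D.nabla _ (S.frame i))).choose

theorem isConnForm_connForm (S : L.Framing 𝒰) (D : Connection L) (i : X) :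
    D.IsConnForm (S.frame i) (S.connForm D i) :=
  ((S.isFrame i).exists_formTensor_eq (D.nabla _ (S.frame i))).choose_spec.symm

theorem connForm_eq (S : L.Framing 𝒰) {D : Connection L} {η : 𝒰.C0Form E}
    (h : ∀ i, D.IsConnForm (S.frame i) (η i)) : S.connForm D = η :=
  funext fun i => (S.isConnForm_connForm D i).unique (S.isFrame i) (h i)

theorem dlogZ1_cocycle (S : L.Framing 𝒰) (D : Connection L) :
    (𝒰.dlogZ1 E S.cocycle).1 = 𝒰.deltaForm E (S.connForm D) := funext₂ fun i j => by
  have hi := (S.isConnForm_connForm D i).res (inf_le_left : 𝒰.toFun i ⊓ 𝒰.toFun j ≤ _)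
  have hj := (S.isConnForm_connForm D j).res (inf_le_right : 𝒰.toFun i ⊓ 𝒰.toFun j ≤ _)
  have hij := hi.unit_smul (S.trans i j).toMul
  rw [S.trans_smul] at hij
  exact eq_sub_of_add_eq' (hij.unique ((S.isFrame j).res inf_le_right) hj)

/-- The hypercocycle of a line bundle with connection with respect to a framing. -/
def connCocycle (S : L.Framing 𝒰) (D : Connection L) : 𝒰.ConnZ1 E :=
  ⟨(S.cocycle, S.connForm D), fun i j => congrFun₂ (S.dlogZ1_cocycle D) i j⟩

theorem connCocycle_eq (S : L.Framing 𝒰) {D : Connection L} {p : 𝒰.ConnZ1 E}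
    (hg : S.cocycle = p.1.1) (hη : ∀ i, D.IsConnForm (S.frame i) (p.1.2 i)) :
    S.connCocycle D = p :=
  Subtype.ext (Prod.ext hg (S.connForm_eq hη))

/-- The connection over a subset of the member of the covering with index `i` whose connection form
with respect to the given frame is `η i`. -/
def localNabla (S : L.Framing 𝒰) (η : 𝒰.C0Form E) {i : X} (h : W ≤ 𝒰.toFun i) :
    L.sec W →ₗ[ℂ] L.form W :=
  ((S.isFrame i).res h).nabla (HolSec.res h (η i))

theorem localNabla_res (S : L.Framing 𝒰) (η : 𝒰.C0Form E) {i : X} (h : W ≤ 𝒰.toFun i)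
    (hU : U ≤ W) (s : L.sec W) :
    S.localNabla η (hU.trans h) (HolSec.res hU s) = HolSec.res hU (S.localNabla η h s) :=
  ((S.isFrame i).res h).nabla_res (HolSec.res h (η i)) hU s

theorem localNabla_congr {S : L.Framing 𝒰} {p : 𝒰.ConnZ1 E} (hp : S.cocycle = p.1.1) {i j : X}
    (hi : W ≤ 𝒰.toFun i) (hj : W ≤ 𝒰.toFun j) :
    S.localNabla p.1.2 hj = S.localNabla p.1.2 hi :=
  IsFrame.nabla_congr _ _ (S.unitRes_trans_smul (le_inf hi hj)) <| by
    rw [ofMul_toMul, ← PointCover.ConnZ1.add_dlog p (le_inf hi hj), ← hp]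
    rfl

end LineBundle.Framing

section OfConnCocycle

variable {E : Type*} [NormedAddCommGroup E] [NormedSpace ℂ E]
  {X : Type*} [TopologicalSpace X] [ChartedSpace E X] [IsManifold 𝓘(ℂ, E) ω X]
  {𝒰 : PointCover X} {U W : Opens X}

namespace LineBundle.Framing

variable {L : LineBundle E X} {p : 𝒰.ConnZ1 E}

/-- The value at `x` of the glued connection, read off in the frame with index `x`. -/
def nablaAt (S : L.Framing 𝒰) (η : 𝒰.C0Form E) (s : L.sec U) (x : U) :
    TangentSpace 𝓘(ℂ, E) (x : X) →L[ℂ] L.fiber x :=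
  (S.localNabla η (inf_le_right : U ⊓ 𝒰.toFun x ≤ _) (HolSec.res inf_le_left s)).1
    ⟨x, x.2, 𝒰.mem x⟩

theorem nablaAt_eq {S : L.Framing 𝒰} (hp : S.cocycle = p.1.1) {i : X} (hi : W ≤ 𝒰.toFun i)
    (hU : W ≤ U) (s : L.sec U) (x : W) :
    S.nablaAt p.1.2 s ⟨x, hU x.2⟩ = (S.localNabla p.1.2 hi (HolSec.res hU s)).1 x := by
  have hx := S.localNabla_res p.1.2 (inf_le_right : U ⊓ 𝒰.toFun x ≤ _)
    (inf_le_inf_right _ hU : W ⊓ 𝒰.toFun x ≤ _) (HolSec.res inf_le_left s)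
  have hi' := S.localNabla_res p.1.2 hi (inf_le_left : W ⊓ 𝒰.toFun x ≤ _) (HolSec.res hU s)
  have h := localNabla_congr hp (inf_le_right : W ⊓ 𝒰.toFun x ≤ _) (inf_le_left.trans hi)
  rw [h] at hi'
  exact congrFun (congrArg Subtype.val (hx.symm.trans hi')) ⟨x, x.2, 𝒰.mem x⟩

theorem nablaAt_add (S : L.Framing 𝒰) (η : 𝒰.C0Form E) (s t : L.sec U) (x : U) :
    S.nablaAt η (s + t) x = S.nablaAt η s x + S.nablaAt η t x := by
  unfold nablaAt
  rw [map_add, map_add]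
  rfl

theorem nablaAt_smul (S : L.Framing 𝒰) (η : 𝒰.C0Form E) (c : ℂ) (s : L.sec U) (x : U) :
    S.nablaAt η (c • s) x = c • S.nablaAt η s x := by
  unfold nablaAt
  rw [show HolSec.res inf_le_left (c • s) = c • HolSec.res inf_le_left s from rfl, map_smul]
  rfl

theorem nablaAt_mem_holSec {S : L.Framing 𝒰} (hp : S.cocycle = p.1.1) (s : L.sec U) :
    (fun x : U => S.nablaAt p.1.2 s x) ∈ holSec E (E →L[ℂ] ℂ)
      (fun x : X => TangentSpace 𝓘(ℂ, E) x →L[ℂ] L.fiber x) U :=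
  mem_holSec_of_local fun x hx => ⟨U ⊓ 𝒰.toFun x, ⟨hx, 𝒰.mem x⟩,
    S.localNabla p.1.2 inf_le_right (HolSec.res inf_le_left s),
    fun y _ hy => (nablaAt_eq hp inf_le_right inf_le_left s ⟨y, hy⟩).symm⟩

/-- The connection whose connection forms with respect to the framing `S` are the components of
`p.1.2`. -/
def connection (S : L.Framing 𝒰) (hp : S.cocycle = p.1.1) : Connection L where
  nabla U :=
    { toFun := fun s => ⟨S.nablaAt p.1.2 s, nablaAt_mem_holSec hp s⟩
      map_add' := fun s t => Subtype.ext (funext (S.nablaAt_add p.1.2 s t))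
      map_smul' := fun c s => Subtype.ext (funext (S.nablaAt_smul p.1.2 c s)) }
  nabla_res {U W} h s := HolSec.ext fun x => (nablaAt_eq hp
    (inf_le_right : W ⊓ 𝒰.toFun x ≤ _) (inf_le_left.trans h) s ⟨x, x.2, 𝒰.mem x⟩).symm
  leibniz {U} f s x v := by
    have h := ((S.isFrame x).res (inf_le_right : U ⊓ 𝒰.toFun x ≤ _)).nabla_smul
      (HolSec.res inf_le_right (p.1.2 x)) (holFun.res inf_le_left f) (HolSec.res inf_le_left s)
    rw [dForm_res] at h
    exact congrArg (fun η : L.form (U ⊓ 𝒰.toFun x) => η.1 ⟨x, x.2, 𝒰.mem x⟩ v) h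

theorem isConnForm_connection (S : L.Framing 𝒰) (hp : S.cocycle = p.1.1) (i : X) :
    (S.connection hp).IsConnForm (S.frame i) (p.1.2 i) :=
  HolSec.ext fun x => (nablaAt_eq hp le_rfl le_rfl (S.frame i) x).trans
    (congrFun (congrArg Subtype.val ((S.isFrame i).nabla_self (p.1.2 i))) x)

theorem connCocycle_connection (S : L.Framing 𝒰) (hp : S.cocycle = p.1.1) :
    S.connCocycle (S.connection hp) = p :=
  S.connCocycle_eq hp (S.isConnForm_connection hp)

end LineBundle.Framing

end OfConnCocycle

section ConnCocycleFunctoriality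

variable {E : Type*} [NormedAddCommGroup E] [NormedSpace ℂ E]
  {X : Type*} [TopologicalSpace X] [ChartedSpace E X] [IsManifold 𝓘(ℂ, E) ω X]
  {𝒰 𝒱 : PointCover X}

namespace LineBundle.Framing

variable {P Q R : ConnLineBundle E X}

theorem connCocycle_res {L : LineBundle E X} (S : L.Framing 𝒰) (D : Connection L) (h : 𝒰 ≤ 𝒱) :
    (S.res h).connCocycle D = PointCover.resConnZ1 h (S.connCocycle D) :=
  connCocycle_eq _ (S.cocycle_res h) fun i => (S.isConnForm_connForm D i).res (h i)

theorem connCocycle_map (S : P.bundle.Framing 𝒰) (φ : ConnLineBundle.Iso P Q) :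
    (S.map φ.toIso).connCocycle Q.conn = S.connCocycle P.conn :=
  connCocycle_eq _ (S.cocycle_map φ.toIso) fun i => φ.isConnForm (S.isConnForm_connForm P.conn i)

theorem connCocycle_tmul (S : P.bundle.Framing 𝒰) (T : Q.bundle.Framing 𝒰)
    (τ : ConnLineBundle.TensorProduct P Q R) :
    (S.tmul T τ.toTensorProduct).connCocycle R.conn =
      S.connCocycle P.conn + T.connCocycle Q.conn :=
  connCocycle_eq _ (S.cocycle_tmul T τ.toTensorProduct) fun i =>
    τ.isConnForm (S.isConnForm_connForm P.conn i) (T.isConnForm_connForm Q.conn i)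

theorem isConnForm_frame {L : LineBundle E X} {S : L.Framing 𝒰} {D : Connection L}
    {p : 𝒰.ConnZ1 E} (h : S.connCocycle D = p) (i : X) : D.IsConnForm (S.frame i) (p.1.2 i) :=
  h ▸ S.isConnForm_connForm D i

/-- The isomorphism of line bundles with connection which carries a framing to a framing with the
same hypercocycle. -/
def connIso {S : P.bundle.Framing 𝒰} {T : Q.bundle.Framing 𝒰}
    (h : S.connCocycle P.conn = T.connCocycle Q.conn) : ConnLineBundle.Iso P Q where
  toIso := iso (congrArg (·.1.1) h)
  comm U s x v := by
    have hη := isConnForm_frame h x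
    have hθ := T.isConnForm_connForm Q.conn x
    rw [← iso_map_frame (congrArg (·.1.1) h : S.cocycle = T.cocycle)] at hθ
    have hW : U ⊓ 𝒰.toFun x ≤ 𝒰.toFun x := inf_le_right
    have hx := Connection.IsConnForm.iso_comm ((S.isFrame x).res hW) (hη.res hW) (hθ.res hW)
      (HolSec.res inf_le_left s) ⟨x, x.2, 𝒰.mem x⟩ v
    rw [P.conn.nabla_res_apply] at hx
    exact (Q.conn.nabla_res_apply inf_le_left _ ⟨x, x.2, 𝒰.mem x⟩ v).symm.trans hx

/-- The tensor product of line bundles with connection given by framings such that the hypercocycle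
of the third one is the sum of the other two. -/
def connTensorProduct {S : P.bundle.Framing 𝒰} {T : Q.bundle.Framing 𝒰} {V : R.bundle.Framing 𝒰}
    (h : V.connCocycle R.conn = S.connCocycle P.conn + T.connCocycle Q.conn) :
    ConnLineBundle.TensorProduct P Q R where
  toTensorProduct := tensorProduct (congrArg (·.1.1) h)
  nabla_tmul U s t x v := by
    have hη := S.isConnForm_connForm P.conn x
    have hθ := T.isConnForm_connForm Q.conn x
    have hζ := isConnForm_frame h x
    rw [← tensorProduct_tmul_frame (congrArg (·.1.1) h : V.cocycle = S.cocycle + T.cocycle)] at hζ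
    have hW : U ⊓ 𝒰.toFun x ≤ 𝒰.toFun x := inf_le_right
    have hx := Connection.IsConnForm.nabla_tmul ((S.isFrame x).res hW) ((T.isFrame x).res hW)
      (hη.res hW) (hθ.res hW) (hζ.res hW) (HolSec.res inf_le_left s) (HolSec.res inf_le_left t)
      ⟨x, x.2, 𝒰.mem x⟩ v
    rw [P.conn.nabla_res_apply, Q.conn.nabla_res_apply] at hx
    exact (R.conn.nabla_res_apply inf_le_left _ ⟨x, x.2, 𝒰.mem x⟩ v).symm.trans hx

end LineBundle.Framing

/-- The line bundle with connection defined by a hypercocycle. -/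
def ConnLineBundle.ofConnCocycle (p : 𝒰.ConnZ1 E) : ConnLineBundle E X where
  bundle := .ofCocycle p.1.1
  conn := (LineBundle.cocycleFraming p.1.1).connection (LineBundle.cocycle_cocycleFraming p.1.1)

/-- The tautological frames of the line bundle with connection defined by a hypercocycle. -/
def ConnLineBundle.hypercocycleFraming (p : 𝒰.ConnZ1 E) : (ofConnCocycle p).bundle.Framing 𝒰 :=
  LineBundle.cocycleFraming p.1.1

theorem ConnLineBundle.connCocycle_hypercocycleFraming (p : 𝒰.ConnZ1 E) :
    (hypercocycleFraming p).connCocycle (ofConnCocycle p).conn = p :=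
  LineBundle.Framing.connCocycle_connection _ (LineBundle.cocycle_cocycleFraming p.1.1)

theorem LineBundle.Framing.cls_ofConnCocycle {P : ConnLineBundle E X} (S : P.bundle.Framing 𝒰)
    {p : 𝒰.ConnZ1 E} (h : S.connCocycle P.conn = p) :
    (ConnLineBundle.ofConnCocycle p).cls = P.cls :=
  Quotient.sound ⟨Framing.connIso
    ((ConnLineBundle.connCocycle_hypercocycleFraming p).trans h.symm)⟩

/-- The bundle with connection defined by a sum of hypercocycles is the tensor product of the
bundles with connection defined by the summands. -/
def ConnLineBundle.ofConnCocycleTensorProduct (p q : 𝒰.ConnZ1 E) :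
    TensorProduct (ofConnCocycle p) (ofConnCocycle q) (ofConnCocycle (p + q)) :=
  LineBundle.Framing.connTensorProduct <| (connCocycle_hypercocycleFraming _).trans <|
    (congrArg₂ (· + ·) (connCocycle_hypercocycleFraming p) (connCocycle_hypercocycleFraming q)).symm

end ConnCocycleFunctoriality

section CechClasses

variable {E : Type*} [NormedAddCommGroup E] [NormedSpace ℂ E]
  {X : Type*} [TopologicalSpace X] [ChartedSpace E X]
  {F : Type*} [NormedAddCommGroup F] [NormedSpace ℂ F]
  {V : X → Type*} [TopologicalSpace (TotalSpace F V)] [∀ x, AddCommGroup (V x)]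
  [∀ x, Module ℂ (V x)] [∀ x, TopologicalSpace (V x)] [FiberBundle F V] [VectorBundle ℂ F V]

variable (E F V) in
instance : DirectedSystem (fun 𝒰 : PointCover X => 𝒰.H1 E F V)
    fun 𝒰 𝒱 h => PointCover.resH1 E F V 𝒰 𝒱 h where
  map_self _ c := by
    obtain ⟨c, rfl⟩ := QuotientAddGroup.mk_surjective c
    rfl
  map_map _ _ _ _ _ c := by
    obtain ⟨c, rfl⟩ := QuotientAddGroup.mk_surjective c
    rfl

variable {𝒰 𝒱 : PointCover X}

theorem cechClass_add (c d : 𝒰.Z1 E F V) : cechClass (c + d) = cechClass c + cechClass d := by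
  unfold cechClass
  rw [map_add, map_add]
  rfl

theorem cechClass_res (h : 𝒰 ≤ 𝒱) (c : 𝒰.Z1 E F V) :
    cechClass (PointCover.resZ1 E F V h c) = cechClass c := by
  classical
  exact AddCommGroup.DirectLimit.of_f (G := fun 𝒰 : PointCover X => 𝒰.H1 E F V)
    (f := PointCover.resH1 E F V) h (𝒰.toH1 E F V c)

theorem toH1_eq_zero_iff (c : 𝒰.Z1 E F V) :
    𝒰.toH1 E F V c = 0 ↔ ∃ b, 𝒰.delta0 E F V b = c.1 :=
  QuotientAddGroup.eq_zero_iff (N := (𝒰.delta0 E F V).range.addSubgroupOf (𝒰.Z1 E F V)) c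

theorem cechClass_eq_zero_iff (c : 𝒰.Z1 E F V) :
    cechClass c = 0 ↔
      ∃ (𝒱 : PointCover X) (h : 𝒰 ≤ 𝒱) (b : 𝒱.C0 E F V),
        𝒱.delta0 E F V b = PointCover.resC1 E F V h c.1 := by
  classical
  constructor
  · intro hc
    obtain ⟨𝒱, h, hc⟩ := AddCommGroup.DirectLimit.of.zero_exact
      (G := fun 𝒰 : PointCover X => 𝒰.H1 E F V) (f := PointCover.resH1 E F V) 𝒰 _ hc
    exact ⟨𝒱, h, (toH1_eq_zero_iff (PointCover.resZ1 E F V h c)).1 hc⟩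
  · rintro ⟨𝒱, h, hc⟩
    rw [← cechClass_res h, cechClass, (toH1_eq_zero_iff (PointCover.resZ1 E F V h c)).2 hc]
    exact map_zero _

theorem cechClass_congr {c d : 𝒰.Z1 E F V} (b : 𝒰.C0 E F V) (h : c.1 + 𝒰.delta0 E F V b = d.1) :
    cechClass c = cechClass d := by
  have hdc : cechClass (d - c) = 0 :=
    (cechClass_eq_zero_iff _).2 ⟨𝒰, le_rfl, b, eq_sub_of_add_eq' h⟩
  rw [← sub_add_cancel d c, cechClass_add, hdc, zero_add]

end CechClasses

section PicardGroups

variable {E : Type*} [NormedAddCommGroup E] [NormedSpace ℂ E]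
  {X : Type*} [TopologicalSpace X] [ChartedSpace E X] [IsManifold 𝓘(ℂ, E) ω X]
  {𝒰 : PointCover X}

open LineBundle

namespace PicAn

theorem cls_ofCocycle_add_right_congr {x y : 𝒰.UnitZ1 E} (z : 𝒰.UnitZ1 E)
    (h : (ofCocycle x).cls = (ofCocycle y).cls) :
    (ofCocycle (x + z)).cls = (ofCocycle (y + z)).cls := by
  obtain ⟨φ⟩ := Quotient.exact h
  refine (((cocycleFraming x).map φ).tmul (cocycleFraming z)
    (ofCocycleTensorProduct y z)).cls_ofCocycle ?_
  rw [Framing.cocycle_tmul, Framing.cocycle_map, cocycle_cocycleFraming, cocycle_cocycleFraming]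

variable (E X) in
/-- The presentation of the Picard group by cocycles with values in `𝒪^*`. -/
def presentation :
    DirectedPresentation (G := fun 𝒰 : PointCover X => 𝒰.UnitZ1 E)
      (fun _ _ h => PointCover.resUnitZ1 h) (PicAn E X) where
  toFun _ g := (ofCocycle g).cls
  map_res h g := ((cocycleFraming g).res h).cls_ofCocycle <| by
    rw [Framing.cocycle_res, cocycle_cocycleFraming]
  exists_rep q := by
    induction q using Quotient.inductionOn with | _ L
    obtain ⟨𝒰, ⟨S⟩⟩ := L.exists_framing
    exact ⟨𝒰, S.cocycle, S.cls_ofCocycle rfl⟩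
  add_right_congr := cls_ofCocycle_add_right_congr

instance : AddCommGroup (PicAn E X) := (presentation E X).addCommGroup

theorem cls_ofCocycle_add (g h : 𝒰.UnitZ1 E) :
    (ofCocycle (g + h)).cls = (ofCocycle g).cls + (ofCocycle h).cls :=
  (presentation E X).map_add g h

theorem cls_ofCocycle_zero : (ofCocycle (0 : 𝒰.UnitZ1 E)).cls = 0 := by
  simpa only [add_zero, left_eq_add] using cls_ofCocycle_add (0 : 𝒰.UnitZ1 E) 0

end PicAn

theorem LineBundle.TensorProduct.cls_eq {L M N : LineBundle E X}
    (τ : LineBundle.TensorProduct L M N) : N.cls = L.cls + M.cls := by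
  obtain ⟨𝒰, ⟨S⟩, ⟨T⟩⟩ := L.exists_framing₂ M
  rw [← S.cls_ofCocycle rfl, ← T.cls_ofCocycle rfl, ← PicAn.cls_ofCocycle_add,
    (S.tmul T τ).cls_ofCocycle (S.cocycle_tmul T τ)]

theorem LineBundle.exists_tensorProduct (L M : LineBundle E X) :
    ∃ N, Nonempty (LineBundle.TensorProduct L M N) := by
  obtain ⟨𝒰, ⟨S⟩, ⟨T⟩⟩ := L.exists_framing₂ M
  exact ⟨_, ⟨Framing.tensorProduct (cocycle_cocycleFraming (S.cocycle + T.cocycle))⟩⟩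

namespace PicC

open ConnLineBundle

theorem cls_ofConnCocycle_add_right_congr {x y : 𝒰.ConnZ1 E} (z : 𝒰.ConnZ1 E)
    (h : (ofConnCocycle x).cls = (ofConnCocycle y).cls) :
    (ofConnCocycle (x + z)).cls = (ofConnCocycle (y + z)).cls := by
  obtain ⟨φ⟩ := Quotient.exact h
  refine (((hypercocycleFraming x).map φ.toIso).tmul (hypercocycleFraming z)
    (ofConnCocycleTensorProduct y z).toTensorProduct).cls_ofConnCocycle ?_
  rw [Framing.connCocycle_tmul, Framing.connCocycle_map, connCocycle_hypercocycleFraming,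
    connCocycle_hypercocycleFraming]

variable (E X) in
/-- The presentation of the group of line bundles with connection by hypercocycles. -/
def presentation :
    DirectedPresentation (G := fun 𝒰 : PointCover X => 𝒰.ConnZ1 E)
      (fun _ _ h => PointCover.resConnZ1 h) (PicC E X) where
  toFun _ p := (ofConnCocycle p).cls
  map_res h p := ((hypercocycleFraming p).res h).cls_ofConnCocycle <| by
    rw [Framing.connCocycle_res, connCocycle_hypercocycleFraming]
  exists_rep q := by
    induction q using Quotient.inductionOn with | _ P
    obtain ⟨𝒰, ⟨S⟩⟩ := P.bundle.exists_framing
    exact ⟨𝒰, S.connCocycle P.conn, S.cls_ofConnCocycle rfl⟩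
  add_right_congr := cls_ofConnCocycle_add_right_congr

instance : AddCommGroup (PicC E X) := (presentation E X).addCommGroup

theorem cls_ofConnCocycle_add (p q : 𝒰.ConnZ1 E) :
    (ofConnCocycle (p + q)).cls = (ofConnCocycle p).cls + (ofConnCocycle q).cls :=
  (presentation E X).map_add p q

end PicC

theorem ConnLineBundle.TensorProduct.cls_eq {P Q R : ConnLineBundle E X}
    (τ : ConnLineBundle.TensorProduct P Q R) : R.cls = P.cls + Q.cls := by
  obtain ⟨𝒰, ⟨S⟩, ⟨T⟩⟩ := P.bundle.exists_framing₂ Q.bundle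
  calc R.cls = (ofConnCocycle (S.connCocycle P.conn + T.connCocycle Q.conn)).cls :=
        ((S.tmul T τ.toTensorProduct).cls_ofConnCocycle (Framing.connCocycle_tmul S T τ)).symm
    _ = (ofConnCocycle (S.connCocycle P.conn)).cls + (ofConnCocycle (T.connCocycle Q.conn)).cls :=
        PicC.cls_ofConnCocycle_add _ _
    _ = P.cls + Q.cls :=
        congrArg₂ (· + ·) (S.cls_ofConnCocycle rfl) (T.cls_ofConnCocycle rfl)

theorem ConnLineBundle.exists_tensorProduct (P Q : ConnLineBundle E X) :
    ∃ R, Nonempty (ConnLineBundle.TensorProduct P Q R) := by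
  obtain ⟨𝒰, ⟨S⟩, ⟨T⟩⟩ := P.bundle.exists_framing₂ Q.bundle
  exact ⟨_, ⟨Framing.connTensorProduct
    (connCocycle_hypercocycleFraming (S.connCocycle P.conn + T.connCocycle Q.conn))⟩⟩

end PicardGroups

section AtiyahClasses

variable {E : Type*} [NormedAddCommGroup E] [NormedSpace ℂ E]
  {X : Type*} [TopologicalSpace X] [ChartedSpace E X] [IsManifold 𝓘(ℂ, E) ω X]
  {L : LineBundle E X} {𝒰 𝒱 : PointCover X}

open LineBundle

theorem PointCover.dlogZ1_resUnitZ1 (h : 𝒰 ≤ 𝒱) (g : 𝒰.UnitZ1 E) :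
    𝒱.dlogZ1 E (resUnitZ1 h g) = resZ1 E _ _ h (𝒰.dlogZ1 E g) :=
  Subtype.ext <| funext₂ fun _ _ => dlog_unitRes _ _

/-- The class of `dlog g` in `H¹(X, Ω¹)`, for a cocycle `g` with values in `𝒪^*`. -/
def dlogClass : 𝒰.UnitZ1 E →+ H1Form E X :=
  .mk' (fun g => cechClass (𝒰.dlogZ1 E g)) fun g h =>
    (congrArg cechClass (map_add (𝒰.dlogZ1 E) g h)).trans (cechClass_add _ _)

theorem dlogClass_resUnitZ1 (h : 𝒰 ≤ 𝒱) (g : 𝒰.UnitZ1 E) :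
    dlogClass (PointCover.resUnitZ1 h g) = dlogClass g :=
  (congrArg cechClass (PointCover.dlogZ1_resUnitZ1 h g)).trans (cechClass_res h _)

theorem LineBundle.Framing.dlogClass_cocycle_congr (S T : L.Framing 𝒰) :
    dlogClass S.cocycle = dlogClass T.cocycle := by
  choose u hu using fun i => (S.isFrame i).exists_unit_smul_eq (T.isFrame i)
  have hres {i : X} {W : Opens X} (h : W ≤ 𝒰.toFun i) :
      (unitRes h (.ofMul (u i))).toMul • HolSec.res h (S.frame i) = HolSec.res h (T.frame i) :=
    congrArg (HolSec.res h) (hu i)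
  have htrans (i j : X) : S.trans i j + unitRes inf_le_right (.ofMul (u j)) =
      unitRes inf_le_left (.ofMul (u i)) + T.trans i j := by
    refine ((S.isFrame i).res inf_le_left).unit_smul_injective ?_
    change (S.trans i j + unitRes _ _).toMul • _ = (unitRes _ _ + T.trans i j).toMul • _
    rw [add_comm, toMul_add, mul_smul, S.trans_smul, hres, add_comm, toMul_add, mul_smul, hres,
      T.trans_smul]
  refine cechClass_congr (fun i => dlog _ (.ofMul (u i))) (funext₂ fun i j => ?_)
  change dlog _ (S.trans i j) + (HolSec.res _ (dlog _ _) - HolSec.res _ (dlog _ _)) =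
    dlog _ (T.trans i j)
  rw [← dlog_unitRes, ← dlog_unitRes, ← add_sub_assoc, ← map_add, htrans, map_add,
    add_sub_cancel_left]

theorem dlogClass_congr {g h : 𝒰.UnitZ1 E} (hgh : (ofCocycle g).cls = (ofCocycle h).cls) :
    dlogClass g = dlogClass h := by
  obtain ⟨φ⟩ := Quotient.exact hgh
  have hφ := ((cocycleFraming g).map φ).dlogClass_cocycle_congr (cocycleFraming h)
  rwa [Framing.cocycle_map, cocycle_cocycleFraming, cocycle_cocycleFraming] at hφ

variable (E X) in
/-- The homomorphism `Pic(X) → H¹(X, Ω¹)` which maps the class of a cocycle `g` to the class of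
`dlog g`. -/
def atiyahHom : PicAn E X →+ H1Form E X :=
  (PicAn.presentation E X).lift (fun _ => dlogClass) dlogClass_resUnitZ1 dlogClass_congr

theorem atiyahHom_cls (S : L.Framing 𝒰) : atiyahHom E X L.cls = dlogClass S.cocycle :=
  (congrArg (atiyahHom E X) (S.cls_ofCocycle rfl).symm).trans
    ((PicAn.presentation E X).lift_apply _ _ _ S.cocycle)

theorem nonempty_connection_iff (L : LineBundle E X) :
    Nonempty (Connection L) ↔ atiyahHom E X L.cls = 0 := by
  obtain ⟨𝒰, ⟨S⟩⟩ := L.exists_framing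
  rw [atiyahHom_cls S]
  refine Iff.trans ?_ (cechClass_eq_zero_iff _).symm
  constructor
  · rintro ⟨D⟩
    exact ⟨𝒰, le_rfl, S.connForm D, (S.dlogZ1_cocycle D).symm⟩
  · rintro ⟨𝒱, h, η, hη⟩
    have hp : ((S.res h).cocycle, η) ∈ 𝒱.ConnZ1 E := fun i j => by
      rw [S.cocycle_res]
      exact congrFun₂ ((congrArg Subtype.val
        (PointCover.dlogZ1_resUnitZ1 h S.cocycle)).trans hη.symm) i j
    exact ⟨(S.res h).connection (p := ⟨_, hp⟩) rfl⟩

namespace LocalFrames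

/-- The framing underlying local trivializations. -/
def framing (T : LocalFrames L) : L.Framing T.cover := ⟨T.frame, T.frame_ne_zero⟩

theorem dlogZ1_cocycle_framing (T : LocalFrames L) :
    (T.cover.dlogZ1 E T.framing.cocycle).1 = T.dlogTrans := funext₂ fun i j =>
  congrArg (dlog _) (T.framing.trans_eq (T.frame_eq i j).symm)

end LocalFrames

theorem LocalFrames.atiyahHom_cls (T : LocalFrames L) :
    ∃ h : T.dlogTrans ∈ Z1Form T.cover, atiyahHom E X L.cls = cechClass ⟨T.dlogTrans, h⟩ :=
  ⟨T.dlogZ1_cocycle_framing ▸ (T.cover.dlogZ1 E T.framing.cocycle).2,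
    (HolLine.atiyahHom_cls T.framing).trans <| congrArg cechClass <| Subtype.ext
      T.dlogZ1_cocycle_framing⟩

end AtiyahClasses

section GlobalFrames

variable {E : Type*} [NormedAddCommGroup E] [NormedSpace ℂ E]
  {X : Type*} [TopologicalSpace X] [ChartedSpace E X]

namespace LineBundle

variable {L : LineBundle E X} {e : L.sec ⊤}

/-- The framing over the covering by copies of `X` given by a global frame. -/
def Framing.ofGlobal (he : IsFrame e) : L.Framing (.whole X) := ⟨fun _ => e, fun _ => he⟩

theorem Framing.cocycle_ofGlobal (he : IsFrame e) : (ofGlobal he).cocycle = 0 :=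
  Subtype.ext <| funext₂ fun _ _ => (ofGlobal he).trans_eq (one_smul _ _)

variable (E X) in
/-- The global frame `1` of the trivial line bundle. -/
def trivialFrame : (trivial E X).sec ⊤ :=
  ⟨fun _ => (1 : ℂ), fun _ => (1 : ℂ),
    fun _ _ => (Bundle.contMDiffWithinAt_section ..).2 contMDiffWithinAt_const, fun _ => rfl⟩

theorem isFrame_trivialFrame : IsFrame (trivialFrame E X) := fun _ => one_ne_zero (α := ℂ)

end LineBundle

variable [IsManifold 𝓘(ℂ, E) ω X]

open LineBundle ConnLineBundle

theorem LineBundle.cls_eq_zero_iff {L : LineBundle E X} :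
    L.cls = 0 ↔ ∃ e : L.sec ⊤, IsFrame e := by
  have cls_eq_zero {L : LineBundle E X} {e : L.sec ⊤} (he : IsFrame e) : L.cls = 0 :=
    ((Framing.ofGlobal he).cls_ofCocycle (Framing.cocycle_ofGlobal he)).symm.trans
      PicAn.cls_ofCocycle_zero
  refine ⟨fun h => ?_, fun ⟨_, he⟩ => cls_eq_zero he⟩
  obtain ⟨φ⟩ := Quotient.exact ((cls_eq_zero isFrame_trivialFrame).trans h.symm)
  exact ⟨φ.map (trivialFrame E X), isFrame_trivialFrame.map φ⟩

theorem isConnForm_trivialFrame (η : holForm E (⊤ : Opens X)) :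
    (trivialConn η).IsConnForm (trivialFrame E X) η :=
  isConnForm_trivialConn η fun _ => rfl

/-- A global `1`-form `η` as a hypercocycle `(1, η)`. -/
def formConnZ1 : holForm E (⊤ : Opens X) →+ (PointCover.whole X).ConnZ1 E where
  toFun η := ⟨(0, fun _ => η), fun _ _ => (map_zero _).trans (sub_self _).symm⟩
  map_zero' := rfl
  map_add' _ _ := Subtype.ext (Prod.ext (add_zero 0).symm rfl)

theorem connCocycle_ofGlobal {L : LineBundle E X} {D : Connection L} {e : L.sec ⊤}
    {η : holForm E (⊤ : Opens X)} (he : IsFrame e) (h : D.IsConnForm e η) :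
    (Framing.ofGlobal he).connCocycle D = formConnZ1 η :=
  Framing.connCocycle_eq _ (Framing.cocycle_ofGlobal he) fun _ => h

theorem formToPicC_eq_cls_iff {η : holForm E (⊤ : Opens X)} {P : ConnLineBundle E X} :
    formToPicC η = P.cls ↔ ∃ e : P.bundle.sec ⊤, IsFrame e ∧ P.conn.IsConnForm e η := by
  constructor
  · intro h
    obtain ⟨φ⟩ := Quotient.exact h
    exact ⟨_, isFrame_trivialFrame.map φ.toIso, φ.isConnForm (isConnForm_trivialFrame η)⟩
  · rintro ⟨e, he, h⟩
    exact Quotient.sound ⟨Framing.connIso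
      ((connCocycle_ofGlobal isFrame_trivialFrame (isConnForm_trivialFrame η)).trans
        (connCocycle_ofGlobal he h).symm)⟩

theorem cls_ofConnCocycle_formConnZ1 (η : holForm E (⊤ : Opens X)) :
    (ofConnCocycle (formConnZ1 η)).cls = formToPicC η :=
  Framing.cls_ofConnCocycle (P := ⟨trivial E X, trivialConn η⟩) (.ofGlobal isFrame_trivialFrame)
    (connCocycle_ofGlobal isFrame_trivialFrame (isConnForm_trivialFrame η))

theorem formToPicC_add (η θ : holForm E (⊤ : Opens X)) :
    formToPicC (η + θ) = formToPicC η + formToPicC θ := by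
  simp only [← cls_ofConnCocycle_formConnZ1, map_add, PicC.cls_ofConnCocycle_add]

theorem forgetConn_add (p q : PicC E X) : forgetConn (p + q) = forgetConn p + forgetConn q := by
  induction p, q using Quotient.inductionOn₂ with | _ P Q
  obtain ⟨R, ⟨τ⟩⟩ := P.exists_tensorProduct Q
  exact (congrArg forgetConn τ.cls_eq).symm.trans τ.toTensorProduct.cls_eq

variable (E X) in
/-- The homomorphism `H⁰(X, Ω¹) → Pic_c(X)`. -/
def formToPicCHom : holForm E (⊤ : Opens X) →+ PicC E X := .mk' formToPicC formToPicC_add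

variable (E X) in
/-- The homomorphism `Pic_c(X) → Pic(X)`. -/
def forgetConnHom : PicC E X →+ PicAn E X := .mk' forgetConn forgetConn_add

theorem exact_dlog_formToPicCHom :
    Function.Exact (dlog (E := E) (⊤ : Opens X)) (formToPicCHom E X) := fun η => by
  have h₀ := isConnForm_trivialFrame (0 : holForm E (⊤ : Opens X))
  rw [← map_zero (formToPicCHom E X)]
  refine formToPicC_eq_cls_iff.trans ⟨fun ⟨e, he, hη⟩ => ?_, fun ⟨u, hu⟩ => ?_⟩
  · obtain ⟨u, rfl⟩ := isFrame_trivialFrame.exists_unit_smul_eq he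
    exact ⟨.ofMul u, (zero_add _).symm.trans ((h₀.unit_smul u).unique he hη)⟩
  · refine ⟨u.toMul • trivialFrame E X, isFrame_trivialFrame.unit_smul _, ?_⟩
    rw [← hu, ← zero_add (dlog _ u)]
    exact h₀.unit_smul u.toMul

theorem exact_formToPicCHom_forgetConnHom :
    Function.Exact (formToPicCHom E X) (forgetConnHom E X) := fun p => by
  induction p using Quotient.inductionOn with | _ P
  refine (cls_eq_zero_iff (L := P.bundle)).trans ⟨fun ⟨e, he⟩ => ?_, fun ⟨η, hη⟩ => ?_⟩
  · obtain ⟨η, hη⟩ := he.exists_formTensor_eq (P.conn.nabla ⊤ e)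
    exact ⟨η, formToPicC_eq_cls_iff.2 ⟨e, he, hη.symm⟩⟩
  · obtain ⟨e, he, -⟩ := formToPicC_eq_cls_iff.1 hη
    exact ⟨e, he⟩

theorem exact_forgetConnHom_atiyahHom :
    Function.Exact (forgetConnHom E X) (atiyahHom E X) := fun q => by
  constructor
  · induction q using Quotient.inductionOn with | _ L
    intro h
    obtain ⟨D⟩ := (nonempty_connection_iff L).2 h
    exact ⟨ConnLineBundle.cls ⟨L, D⟩, rfl⟩
  · rintro ⟨p, rfl⟩
    induction p using Quotient.inductionOn with | _ P
    exact (nonempty_connection_iff P.bundle).1 ⟨P.conn⟩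

end GlobalFrames

end HolLine

end

theorem mainTheorem5_general
    {E : Type*} [NormedAddCommGroup E] [NormedSpace ℂ E]
    {X : Type*} [TopologicalSpace X] [ChartedSpace E X] [IsManifold 𝓘(ℂ, E) ω X] :
    (∀ L M : HolLine.LineBundle E X, ∃ N, Nonempty (HolLine.LineBundle.TensorProduct L M N)) ∧
    (∀ P Q : HolLine.ConnLineBundle E X, ∃ R,
      Nonempty (HolLine.ConnLineBundle.TensorProduct P Q R)) ∧
    ∃ (_ : AddCommGroup (HolLine.PicAn E X)) (_ : AddCommGroup (HolLine.PicC E X)),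
      (∀ L M N : HolLine.LineBundle E X,
        HolLine.LineBundle.TensorProduct L M N → N.cls = L.cls + M.cls) ∧
      (∀ P Q R : HolLine.ConnLineBundle E X,
        HolLine.ConnLineBundle.TensorProduct P Q R → R.cls = P.cls + Q.cls) ∧
      ∃ (a : HolLine.holForm E (⊤ : TopologicalSpace.Opens X) →+ HolLine.PicC E X)
        (b : HolLine.PicC E X →+ HolLine.PicAn E X)
        (c : HolLine.PicAn E X →+ HolLine.H1Form E X),
        (∀ η, a η = HolLine.formToPicC η) ∧
        (∀ p, b p = HolLine.forgetConn p) ∧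
        (∀ L : HolLine.LineBundle E X, Nonempty (HolLine.LocalFrames L)) ∧
        (∀ (L : HolLine.LineBundle E X) (T : HolLine.LocalFrames L),
          ∃ h : T.dlogTrans ∈ HolLine.Z1Form T.cover,
            c L.cls = HolLine.cechClass ⟨T.dlogTrans, h⟩) ∧
        Function.Exact (HolLine.dlog (E := E) (⊤ : TopologicalSpace.Opens X)) a ∧
        Function.Exact a b ∧
        Function.Exact b c ∧
        ∀ L : HolLine.LineBundle E X, Nonempty (HolLine.Connection L) ↔ c L.cls = 0 :=
  ⟨HolLine.LineBundle.exists_tensorProduct, HolLine.ConnLineBundle.exists_tensorProduct,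
    inferInstance, inferInstance, fun _ _ _ => HolLine.LineBundle.TensorProduct.cls_eq,
    fun _ _ _ => HolLine.ConnLineBundle.TensorProduct.cls_eq,
    HolLine.formToPicCHom E X, HolLine.forgetConnHom E X, HolLine.atiyahHom E X,
    fun _ => rfl, fun _ => rfl, HolLine.LineBundle.nonempty_localFrames,
    fun _ => HolLine.LocalFrames.atiyahHom_cls, HolLine.exact_dlog_formToPicCHom,
    HolLine.exact_formToPicCHom_forgetConnHom, HolLine.exact_forgetConnHom_atiyahHom,
    HolLine.nonempty_connection_iff⟩

theorem mainTheorem5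
    {E : Type*} [NormedAddCommGroup E] [NormedSpace ℂ E] [FiniteDimensional ℂ E]
    {X : Type*} [TopologicalSpace X] [T2Space X] [ParacompactSpace X]
    [ChartedSpace E X] [IsManifold 𝓘(ℂ, E) ω X] :
    -- tensor products exist
    (∀ L M : HolLine.LineBundle E X, ∃ N, Nonempty (HolLine.LineBundle.TensorProduct L M N)) ∧
    (∀ P Q : HolLine.ConnLineBundle E X, ∃ R,
      Nonempty (HolLine.ConnLineBundle.TensorProduct P Q R)) ∧
    -- they make the sets of isomorphism classes into abelian groups
    ∃ (_ : AddCommGroup (HolLine.PicAn E X)) (_ : AddCommGroup (HolLine.PicC E X)),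
      (∀ L M N : HolLine.LineBundle E X,
        HolLine.LineBundle.TensorProduct L M N → N.cls = L.cls + M.cls) ∧
      (∀ P Q R : HolLine.ConnLineBundle E X,
        HolLine.ConnLineBundle.TensorProduct P Q R → R.cls = P.cls + Q.cls) ∧
      -- the homomorphisms of the sequence
      ∃ (a : HolLine.holForm E (⊤ : TopologicalSpace.Opens X) →+ HolLine.PicC E X)
        (b : HolLine.PicC E X →+ HolLine.PicAn E X)
        (c : HolLine.PicAn E X →+ HolLine.H1Form E X),
        (∀ η, a η = HolLine.formToPicC η) ∧
        (∀ p, b p = HolLine.forgetConn p) ∧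
        (∀ L : HolLine.LineBundle E X, Nonempty (HolLine.LocalFrames L)) ∧
        (∀ (L : HolLine.LineBundle E X) (T : HolLine.LocalFrames L),
          ∃ h : T.dlogTrans ∈ HolLine.Z1Form T.cover, c L.cls = HolLine.cechClass ⟨T.dlogTrans, h⟩) ∧
        -- exactness
        Function.Exact (HolLine.dlog (E := E) (⊤ : TopologicalSpace.Opens X)) a ∧
        Function.Exact a b ∧
        Function.Exact b c ∧
        -- the criterion for the existence of a connection
        ∀ L : HolLine.LineBundle E X, Nonempty (HolLine.Connection L) ↔ c L.cls = 0 :=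
  mainTheorem5_general
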